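/- Let $\mathbb{K}\subset\mathbb{C}$ be a unital subring and let $R$ be a finite based $\mathbb{R}_{\geq 0}$-algebra, that is, a unital associative $\mathbb{K}$-algebra with a finite $\mathbb{K}$-basis $C=\{1=c_0,\dots,c_{r-1}\}$ such that $c_ic_j=\sum_k m_{i,j}^k\, c_k$ with all $m_{i,j}^k\in\mathbb{R}_{\geq 0}$. Let $c=\sum_i a_i c_i$ with $a_i\in\mathbb{R}_{\geq 0}$ (scalars being extended to $\mathbb{C}$ if the $a_i$ are not in $\mathbb{K}$), and let $b_n=b_n^{R,c}\in\mathbb{R}_{\geq 0}$ be the sum of the coefficients of $c^n$ with respect to $C$. Let $M'(c)_{k,j}=\sum_i a_i m_{i,j}^k$, and let the action matrix $M=M(c)$ be the submatrix of $M'(c)$ whose rows and columns are indexed by the connected component, in the nonoriented sense, of $c_0=1$ in the graph on $C$ with an edge between $c_k$ and $c_j$ whenever $M'(c)_{k,j}\neq 0$. Let $\lambda=\mathrm{PFdim}\,c\in\mathbb{R}_{\geq 0}$ be the Perron--Frobenius eigenvalue of $M$, i.e. its nonnegative real eigenvalue with $\lambda\geq|\mu|$ for all complex eigenvalues $\mu$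 of $M$. Assume that $M$ has the Perron--Frobenius property: $\lambda$ has algebraic multiplicity one as an eigenvalue of $M$. Then there is a unique integer $h\geq 1$ (the period) such that, with $\zeta=\exp(2\pi i/h)$, the numbers $\zeta^k\lambda$, $0\leq k<h$, are pairwise distinct and are precisely the eigenvalues of $M$ of absolute value $\lambda$. For $0\leq k<h$ there are a right eigenvector $v_k$ and a left eigenvector $w_k$ of $M$ over $\mathbb{C}$, so $Mv_k=\zeta^k\lambda\, v_k$ and $w_k^TM=\zeta^k\lambda\, w_k^T$, with $w_k^Tv_k=1$. For every such choice put \[ a(n)=\Big(\sum_{k=0}^{h-1} v_kw_k^T[1]\cdot(\zeta^k)^n\Big)\cdot\lambda^n , \] where $v_kw_k^T[1]$ is the sum of the entries of the column of the matrix $v_kw_k^T$ indexed by $c_0=1$. Let $\lambda^{sec}$ be an eigenvalue of $M$ of largest absolute value among the eigenvalues $\mu$ with $|\mu|<\lambda$ (and $\lambda^{sec}=0$ if there are none), and let $\beta=|\lambda^{sec}|/\lambda$ (and $\beta=0$ if $\lambda=0$, which happens only for $c=0$). Then \[ b_n\sim a(n)\qquad(n\to\infty), \] and the convergence is geometric with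 ratio $\beta\in[0,1)$: for every $\gamma\in(\beta,1)$ the sequences $\big(b_n/a(n)-1\big)/\gamma^n$ and $\big((b_n-a(n))/\lambda^n\big)/\gamma^n$, $n\geq 0$, are bounded if $c\neq 0$ (for $c=0$ the relation $b_n\sim a(n)$ means that $b_n=a(n)$ for all large $n$). In particular, \[ \lim_{n\to\infty}\sqrt[n]{b_n}=\lambda=\mathrm{PFdim}\,c . \] -/

import Mathlib

open scoped ComplexOrder TensorProduct

noncomputable section

namespace BasedAlgebra

/-- A finite based `ℝ≥0`-algebra: an associative unital algebra `R` over a subring `K` of `ℂ`,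
with a finite `K`-basis that contains `1` and has structure constants in `ℝ≥0`
(for `z : ℂ`, `0 ≤ z` says that `z` is real and nonnegative). -/
structure FiniteBasedAlgebra (K : Subring ℂ) (R : Type*) [Ring R] [Algebra K R]
    (ι : Type*) [Fintype ι] where
  /-- The basis `C`. -/
  basis : Module.Basis ι K R
  /-- The index of the basis element `1`. -/
  one : ι
  basis_one : basis one = 1
  structure_nonneg : ∀ i j k : ι, 0 ≤ ((basis.repr (basis i * basis j) k : K) : ℂ)

/-- Convergence of `f` to `a`, geometrically with ratio `β ∈ [0, 1)`. -/
def ConvergesGeometrically (f : ℕ → ℂ) (a : ℂ) (β : ℝ) : Prop :=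
  0 ≤ β ∧ β < 1 ∧
    ∀ γ : ℝ, β < γ → γ < 1 → ∃ B : ℝ, ∀ n : ℕ, ‖(f n - a) / (γ : ℂ) ^ n‖ ≤ B

section Matrices

variable {m : Type*} [Fintype m] [DecidableEq m]

/-- The set of complex eigenvalues of a real square matrix. -/
def eigenvalues (M : Matrix m m ℝ) : Set ℂ :=
  spectrum ℂ (M.map Complex.ofReal)

/-- The largest absolute value of a complex eigenvalue. A nonnegative real eigenvalue that
dominates all eigenvalues in absolute value is necessarily this number. -/
def pfEigenvalue (M : Matrix m m ℝ) : ℝ :=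
  (spectralRadius ℂ (M.map Complex.ofReal)).toReal

/-- The Perron--Frobenius eigenvalue is an eigenvalue of (algebraic) multiplicity one. -/
def HasPerronFrobeniusProperty (M : Matrix m m ℝ) : Prop :=
  M.charpoly.rootMultiplicity (pfEigenvalue M) = 1

/-- The absolute value of a second largest eigenvalue, i.e. the largest absolute value of an
eigenvalue that is not of maximal absolute value. It is `0` if there is no such eigenvalue. -/
def secondModulus (M : Matrix m m ℝ) : ℝ :=
  sSup ((fun μ : ℂ => ‖μ‖) '' {μ ∈ eigenvalues M | ‖μ‖ < pfEigenvalue M})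

/-- `exp (2 π i / h)`. -/
def zeta (h : ℕ) : ℂ := Complex.exp (2 * Real.pi * Complex.I / h)

/-- `h ≥ 1` is the period: the `h` numbers `ζ ^ k * lam`, `0 ≤ k < h`, are pairwise distinct and
are precisely the eigenvalues of absolute value `lam`, where `lam` is the Perron--Frobenius
eigenvalue and `ζ = exp (2 π i / h)`. -/
def IsPeriod (M : Matrix m m ℝ) (h : ℕ) : Prop :=
  1 ≤ h ∧ Set.BijOn (fun k : ℕ => zeta h ^ k * (pfEigenvalue M : ℂ)) (Set.Iio h)
    {μ ∈ eigenvalues M | ‖μ‖ = pfEigenvalue M}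

/-- `v k` and `w k` are right and left eigenvectors for the eigenvalue `ζ ^ k * lam`, normalized
by `(w k)ᵀ (v k) = 1`. -/
def IsNormalizedEigensystem (M : Matrix m m ℝ) {h : ℕ} (v w : Fin h → m → ℂ) : Prop :=
  ∀ k : Fin h,
    (M.map Complex.ofReal).mulVec (v k) = (zeta h ^ (k : ℕ) * (pfEigenvalue M : ℂ)) • v k ∧
    Matrix.vecMul (w k) (M.map Complex.ofReal) =
      (zeta h ^ (k : ℕ) * (pfEigenvalue M : ℂ)) • w k ∧
    w k ⬝ᵥ v k = 1

/-- The sum of the entries of the column with index `j`. -/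
def columnSum (A : Matrix m m ℂ) (j : m) : ℂ := ∑ i, A i j

/-- The sequence `a(n) = (∑_{k < h} (v_k w_kᵀ)[j] (ζ ^ k) ^ n) lam ^ n`, where `[j]` is the sum
of the entries in column `j`. -/
def asymptoticFormula (M : Matrix m m ℝ) (j : m) {h : ℕ} (v w : Fin h → m → ℂ) (n : ℕ) : ℂ :=
  (∑ k : Fin h, columnSum (Matrix.vecMulVec (v k) (w k)) j * (zeta h ^ (k : ℕ)) ^ n) *
    (pfEigenvalue M : ℂ) ^ n

end Matrices

namespace FiniteBasedAlgebra

variable {K : Subring ℂ} {R : Type*} [Ring R] [Algebra K R] {ι : Type*} [Fintype ι]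
  (C : FiniteBasedAlgebra K R ι)

/-- The structure constant `m_{i,j}^k`, a nonnegative real number. -/
def structureConst (i j k : ι) : ℝ := ((C.basis.repr (C.basis i * C.basis j) k : K) : ℂ).re

/-- The element `∑ i, x i • c_i`. The real numbers `x i` need not lie in `K`, so scalars are
extended to `ℂ`. -/
def element (x : ι → ℝ) : ℂ ⊗[K] R := ∑ i, (x i : ℂ) ⊗ₜ[K] C.basis i

/-- `b_n`: the sum of the coefficients of `c ^ n` in the basis, for `c = ∑ i, x i • c_i`.
(For `x ≥ 0` all these coefficients are nonnegative real numbers.) -/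
def growth (x : ι → ℝ) (n : ℕ) : ℝ :=
  ∑ k, ((C.basis.baseChange ℂ).repr (C.element x ^ n) k).re

/-- The pre-action matrix `M'(c)_{k,j} = ∑ i, x i m_{i,j}^k`. -/
def preActionMatrix (x : ι → ℝ) : Matrix ι ι ℝ :=
  Matrix.of fun k j => ∑ i, x i * C.structureConst i j k

open Classical in
/-- The connected component, in the nonoriented sense, of `1` in the adjacency graph of the
pre-action matrix. -/
def component (x : ι → ℝ) : Finset ι :=
  {i | Relation.EqvGen (fun k j => C.preActionMatrix x k j ≠ 0) C.one i}

/-- The index of `1`, as a vertex of its connected component. -/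
def oneVertex (x : ι → ℝ) : C.component x :=
  ⟨C.one, by simpa [component] using Relation.EqvGen.refl C.one⟩

/-- The action matrix `M(c)`: the part of the pre-action matrix on the component of `1`. -/
def actionMatrix (x : ι → ℝ) : Matrix (C.component x) (C.component x) ℝ :=
  (C.preActionMatrix x).submatrix Subtype.val Subtype.val

end FiniteBasedAlgebra

end BasedAlgebra

end

/-! Left multiplication by `c` has matrix `M'` in the basis `C`, so the coefficients of `c ^ n` form
the column of `M' ^ n` at `1`. The component of `1` is invariant, hence `b_n` is a column sum of `M
^ n` (`growth_eq_sum_actionMatrix`). The rest is spectral theory of a nonnegative matrix, not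
assumed irreducible, whose spectral radius `λ` is a simple eigenvalue.

The peripheral eigenvalues are simple and, divided by `λ > 0`, closed under multiplication
(`rootMultiplicity_peripheral_eq_one`). Splitting into diagonal blocks reduces this to an
irreducible block. There Wielandt's argument applies: the phases of a peripheral eigenvector for `z`
conjugate `M` into `(z / λ) M`, so the characteristic polynomial is invariant, up to a factor, under
rotation by `z / λ`. A finite multiplicatively closed set of nonzero numbers containing `1` is a
group of roots of unity, which gives the period.

Removing the rank-one spectral projections `v_k w_kᵀ` leaves a matrix whose eigenvalues are bounded
by the second modulus. Gelfand's formula turns this into `b_n - a(n) = O(ρ ^ n)` for every larger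
`ρ` (`exists_norm_pow_sub_sum_le`).

The quotient `b_n / a(n)` also needs a lower bound `b_n ≥ const * λ ^ n`
(`exists_mul_pow_le_growth`). This uses the algebra: every entry of `M ^ n` is a combination of
coefficients of `c ^ n` with structure constants as weights, so `b_n` dominates the whole matrix,
and a nonnegative eigenvector shows that some entry grows like `λ ^ n`. -/

namespace BasedAlgebra

open Matrix Polynomial Filter Topology

/-! ### Gelfand's formula and decay of matrix powers. -/

section PowerDecay

theorem exists_forall_le_of_eventually_le {f : ℕ → ℝ} {B : ℝ} (h : ∀ᶠ n in atTop, f n ≤ B) :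
    ∃ B', ∀ n, f n ≤ B' := by
  have hb : IsBoundedUnder (· ≤ ·) atTop f := ⟨B, by simpa using h⟩
  obtain ⟨B', hB'⟩ := hb.bddAbove_range
  exact ⟨B', fun n => hB' ⟨n, rfl⟩⟩

variable {m : Type*} [Fintype m] [DecidableEq m]

attribute [local instance] Matrix.linftyOpNormedRing Matrix.linftyOpNormedAlgebra

theorem norm_entry_le_linftyOpNorm (A : Matrix m m ℂ) (i j : m) : ‖A i j‖ ≤ ‖A‖ := by
  have h : ‖A i j‖₊ ≤ ‖A‖₊ := by
    rw [Matrix.linfty_opNNNorm_def]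
    calc ‖A i j‖₊ ≤ ∑ j, ‖A i j‖₊ :=
          Finset.single_le_sum (f := fun j => ‖A i j‖₊) (fun _ _ => zero_le) (Finset.mem_univ j)
      _ ≤ _ := Finset.le_sup (f := fun i => ∑ j, ‖A i j‖₊) (Finset.mem_univ i)
  exact_mod_cast h

/-- If all eigenvalues have absolute value less than `ρ`, then the powers are `O(ρ ^ n)`. -/
theorem exists_norm_pow_entry_le (A : Matrix m m ℂ) {σ ρ : ℝ} (hσ : σ < ρ) (hρ : 0 < ρ)
    (hA : ∀ z, A.charpoly.IsRoot z → ‖z‖ ≤ σ) :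
    ∃ B, ∀ (n : ℕ) (i j : m), ‖(A ^ n) i j‖ ≤ B * ρ ^ n := by
  have hrad : spectralRadius ℂ A < ENNReal.ofReal ρ := by
    refine lt_of_le_of_lt (b := ENNReal.ofReal σ) ?_ ((ENNReal.ofReal_lt_ofReal_iff hρ).2 hσ)
    refine iSup₂_le fun z hz => ?_
    rw [← enorm_eq_nnnorm, ← ofReal_norm]
    exact ENNReal.ofReal_le_ofReal (hA z (Matrix.mem_spectrum_iff_isRoot_charpoly.1 hz))
  have hev : ∀ᶠ n : ℕ in atTop, ‖A ^ n‖ / ρ ^ n ≤ 1 := by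
    -- Gelfand's formula gives the bound for large `n`; the finitely many remaining `n` only enlarge
    -- the constant.
    have h := (spectrum.pow_norm_pow_one_div_tendsto_nhds_spectralRadius A).eventually
      (gt_mem_nhds hrad)
    filter_upwards [h, eventually_gt_atTop 0] with n hn hn0
    have hn' : ‖A ^ n‖ ^ (1 / n : ℝ) < ρ := (ENNReal.ofReal_lt_ofReal_iff hρ).1 hn
    rw [div_le_one (pow_pos hρ n)]
    calc ‖A ^ n‖ = (‖A ^ n‖ ^ (1 / n : ℝ)) ^ n := by
          rw [one_div, Real.rpow_inv_natCast_pow (norm_nonneg _) hn0.ne']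
      _ ≤ ρ ^ n := pow_le_pow_left₀ (Real.rpow_nonneg (norm_nonneg _) _) hn'.le n
  obtain ⟨B, hB⟩ := exists_forall_le_of_eventually_le hev
  refine ⟨B, fun n i j => (norm_entry_le_linftyOpNorm _ i j).trans ?_⟩
  exact (div_le_iff₀ (pow_pos hρ n)).1 (hB n)

theorem norm_le_pfEigenvalue (M : Matrix m m ℝ) {z : ℂ}
    (hz : (M.map Complex.ofReal).charpoly.IsRoot z) : ‖z‖ ≤ pfEigenvalue M := by
  rcases isEmpty_or_nonempty m with hm | hm
  · simp [Polynomial.IsRoot] at hz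
  have h1 : (‖z‖₊ : ENNReal) ≤ spectralRadius ℂ (M.map Complex.ofReal) :=
    le_iSup₂ (f := fun (k : ℂ) (_ : k ∈ spectrum ℂ (M.map Complex.ofReal)) => (‖k‖₊ : ENNReal)) z
      (Matrix.mem_spectrum_iff_isRoot_charpoly.2 hz)
  obtain ⟨y, -, hy⟩ := spectrum.exists_nnnorm_eq_spectralRadius (M.map Complex.ofReal)
  have h2 : spectralRadius ℂ (M.map Complex.ofReal) ≠ ⊤ := by
    rw [← hy]; exact ENNReal.coe_ne_top
  have := ENNReal.toReal_mono h2 h1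
  simpa [pfEigenvalue] using this

theorem pfEigenvalue_nonneg (M : Matrix m m ℝ) : 0 ≤ pfEigenvalue M := ENNReal.toReal_nonneg

end PowerDecay

/-! ### Entrywise inequalities for nonnegative matrices. -/

section NonnegativeMatrices

variable {m : Type*} [Fintype m]

theorem mulVec_mono {M : Matrix m m ℝ} (hM : ∀ i j, 0 ≤ M i j) {x y : m → ℝ} (h : x ≤ y) :
    M *ᵥ x ≤ M *ᵥ y := fun i =>
  Finset.sum_le_sum fun j _ => mul_le_mul_of_nonneg_left (h j) (hM i j)

theorem smul_norm_le_mulVec_norm {M : Matrix m m ℝ} (hM : ∀ i j, 0 ≤ M i j) {z : ℂ} {u : m → ℂ}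
    (h : (M.map Complex.ofReal) *ᵥ u = z • u) :
    (‖z‖ • fun i => ‖u i‖) ≤ M *ᵥ fun i => ‖u i‖ := by
  intro i
  have := congrFun h i
  calc ‖z‖ * ‖u i‖ = ‖∑ j, (M i j : ℂ) * u j‖ := by
        rw [← norm_mul, ← smul_eq_mul, ← Pi.smul_apply, ← this]; rfl
    _ ≤ ∑ j, ‖(M i j : ℂ) * u j‖ := norm_sum_le _ _
    _ = _ := Finset.sum_congr rfl fun j _ => by
        rw [norm_mul, Complex.norm_real, Real.norm_of_nonneg (hM i j)]

end NonnegativeMatrices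

/-! ### The weak Perron–Frobenius theorem, via the resolvent. -/

section WeakPerronFrobenius

variable {m : Type*} [Fintype m] [DecidableEq m]

theorem exists_eigenvector_of_isRoot_charpoly {A : Matrix m m ℂ} {z : ℂ}
    (hz : A.charpoly.IsRoot z) : ∃ u, u ≠ 0 ∧ A *ᵥ u = z • u := by
  rw [Polynomial.IsRoot, Matrix.eval_charpoly] at hz
  obtain ⟨u, hu, h⟩ := Matrix.exists_mulVec_eq_zero_iff.2 hz
  refine ⟨u, hu, ?_⟩
  rw [Matrix.sub_mulVec, sub_eq_zero] at h
  rw [← h, Matrix.scalar_apply, ← Matrix.smul_one_eq_diagonal, Matrix.smul_mulVec, Matrix.one_mulVec]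

theorem isRoot_charpoly_of_mulVec_eq {F : Type*} [Field F] {A : Matrix m m F} {z : F} {u : m → F}
    (hu : u ≠ 0) (h : A *ᵥ u = z • u) : A.charpoly.IsRoot z := by
  rw [Polynomial.IsRoot, Matrix.eval_charpoly]
  refine Matrix.exists_mulVec_eq_zero_iff.1 ⟨u, hu, ?_⟩
  rw [Matrix.sub_mulVec, h, Matrix.scalar_apply, ← Matrix.smul_one_eq_diagonal, Matrix.smul_mulVec,
    Matrix.one_mulVec, sub_self]

theorem map_ofReal_charpoly (M : Matrix m m ℝ) :
    (M.map Complex.ofReal).charpoly = M.charpoly.map Complex.ofRealHom :=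
  Matrix.charpoly_map M Complex.ofRealHom

theorem isRoot_map_ofReal_charpoly_iff (M : Matrix m m ℝ) (t : ℝ) :
    (M.map Complex.ofReal).charpoly.IsRoot (t : ℂ) ↔ M.charpoly.IsRoot t := by
  rw [map_ofReal_charpoly]
  exact Polynomial.isRoot_map_iff (f := Complex.ofRealHom) Complex.ofReal_injective

/-- If `t` exceeds the absolute value of each eigenvalue of a nonnegative matrix `M`, then
`t - M` is inverse positive. -/
theorem nonneg_of_mulVec_le_smul {M : Matrix m m ℝ} (hM : ∀ i j, 0 ≤ M i j) {r t : ℝ}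
    (hr : ∀ z, (M.map Complex.ofReal).charpoly.IsRoot z → ‖z‖ ≤ r) (h0 : 0 ≤ r) (ht : r < t)
    {y : m → ℝ} (hy : M *ᵥ y ≤ t • y) : 0 ≤ y := by
  have htpos : 0 < t := h0.trans_lt ht
  -- Iterating the hypothesis bounds `t ^ n • y` below by `M ^ n *ᵥ y`, whose entries are `O(ρ ^ n)`
  -- with `r < ρ < t`. Dividing by `t ^ n` and letting `n → ∞` gives `0 ≤ y`.
  have hpow : ∀ n : ℕ, (M ^ n) *ᵥ y ≤ t ^ n • y := by
    intro n
    induction n with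
    | zero => simp
    | succ n ih =>
      rw [pow_succ', ← Matrix.mulVec_mulVec]
      refine (mulVec_mono hM ih).trans ?_
      rw [Matrix.mulVec_smul, pow_succ, mul_smul]
      exact smul_le_smul_of_nonneg_left hy (pow_nonneg htpos.le n)
  obtain ⟨ρ, hρ1, hρ2⟩ := exists_between ht
  have hρpos : 0 < ρ := h0.trans_lt hρ1
  obtain ⟨B, hB⟩ := exists_norm_pow_entry_le (M.map Complex.ofReal) hρ1 hρpos hr
  have hB' : ∀ n i j, |(M ^ n) i j| ≤ B * ρ ^ n := by
    intro n i j
    have h1 : (M.map Complex.ofReal) ^ n = (M ^ n).map Complex.ofReal :=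
      (Matrix.map_pow (f := Complex.ofRealHom) M n).symm
    have := hB n i j
    rwa [h1, Matrix.map_apply, Complex.norm_real, Real.norm_eq_abs] at this
  intro i
  have hlim : Tendsto (fun n : ℕ => -(B * (∑ j, |y j|)) * (ρ / t) ^ n) atTop (𝓝 0) := by
    have := (tendsto_pow_atTop_nhds_zero_of_lt_one (div_nonneg hρpos.le htpos.le)
      ((div_lt_one htpos).2 hρ2)).const_mul (-(B * (∑ j, |y j|)))
    simpa using this
  refine le_of_tendsto hlim (Eventually.of_forall fun n => ?_)
  have h1 : -(B * ρ ^ n * ∑ j, |y j|) ≤ ((M ^ n) *ᵥ y) i := by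
    rw [Finset.mul_sum, ← Finset.sum_neg_distrib]
    refine Finset.sum_le_sum fun j _ => ?_
    refine neg_le.1 ((neg_le_abs _).trans ?_)
    rw [abs_mul]
    exact mul_le_mul_of_nonneg_right (hB' n i j) (abs_nonneg _)
  have h2 := h1.trans (hpow n i)
  have htn : 0 < t ^ n := pow_pos htpos n
  rw [Pi.smul_apply, smul_eq_mul, mul_comm (t ^ n), ← div_le_iff₀ htn] at h2
  refine le_trans (le_of_eq ?_) h2
  rw [div_pow]; ring

/-- The spectral radius of a nonnegative matrix is an eigenvalue with a nonnegative
eigenvector. -/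
theorem exists_nonneg_eigenvector {M : Matrix m m ℝ} (hM : ∀ i j, 0 ≤ M i j) {r : ℝ}
    (hr : ∀ z, (M.map Complex.ofReal).charpoly.IsRoot z → ‖z‖ ≤ r) {z : ℂ}
    (hz : (M.map Complex.ofReal).charpoly.IsRoot z) (hzr : ‖z‖ = r) :
    ∃ v : m → ℝ, 0 ≤ v ∧ v ≠ 0 ∧ M *ᵥ v = r • v := by
  have h0 : 0 ≤ r := hzr ▸ norm_nonneg z
  obtain ⟨u, hu, huz⟩ := exists_eigenvector_of_isRoot_charpoly hz
  set a : m → ℝ := fun i => ‖u i‖ with ha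
  have ha0 : 0 ≤ a := fun i => norm_nonneg _
  have haM : r • a ≤ M *ᵥ a := hzr ▸ smul_norm_le_mulVec_norm hM huz
  have hapos : 0 < ∑ i, a i := by
    obtain ⟨i, hi⟩ := Function.ne_iff.1 hu
    exact Finset.sum_pos' (fun i _ => ha0 i) ⟨i, Finset.mem_univ i, norm_pos_iff.2 hi⟩
  -- Approximate eigenvectors: `y` is the resolvent `(t - M)⁻¹ a`, normalized to have sum `1`. Its
  -- defect tends to zero as `t` decreases to `r`, and compactness of the simplex supplies a limit.
  have key : ∀ t, r < t → ∃ y ∈ stdSimplex ℝ m, ∀ i,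
      |t * y i - (M *ᵥ y) i| ≤ (t - r) * (a i / ∑ i, a i) := by
    intro t ht
    have hdet : (Matrix.scalar m t - M).det ≠ 0 := by
      intro hd
      have h1 : M.charpoly.IsRoot t := by rw [Polynomial.IsRoot, Matrix.eval_charpoly, hd]
      have h2 := hr _ ((isRoot_map_ofReal_charpoly_iff M t).2 h1)
      rw [Complex.norm_real] at h2
      exact absurd ((le_abs_self t).trans h2) (not_le.2 ht)
    set x := (Matrix.scalar m t - M)⁻¹ *ᵥ a with hx
    have hxa : t • x - M *ᵥ x = a := by
      have h1 : (Matrix.scalar m t - M) *ᵥ x = a := by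
        rw [hx, Matrix.mulVec_mulVec, Matrix.mul_nonsing_inv _ (isUnit_iff_ne_zero.2 hdet),
          Matrix.one_mulVec]
      rwa [Matrix.sub_mulVec, Matrix.scalar_apply, ← Matrix.smul_one_eq_diagonal,
        Matrix.smul_mulVec, Matrix.one_mulVec] at h1
    have hx0 : 0 ≤ x := nonneg_of_mulVec_le_smul hM hr h0 ht (by
      rw [← sub_nonneg, hxa]; exact ha0)
    -- Applying `t - M` to this vector gives `M a - r a ≥ 0`, so inverse positivity applies. The
    -- resulting blow-up of `∑ x i` as `t → r` is what makes the normalized defect small.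
    have hxa' : 0 ≤ (t - r) • x - a := nonneg_of_mulVec_le_smul hM hr h0 ht (by
      rw [← sub_nonneg, Matrix.mulVec_sub, Matrix.mulVec_smul]
      have : t • ((t - r) • x - a) - ((t - r) • M *ᵥ x - M *ᵥ a)
          = (t - r) • (t • x - M *ᵥ x) - t • a + M *ᵥ a := by
        ext i; simp; ring
      rw [this, hxa]
      have h2 : (t - r) • a - t • a + M *ᵥ a = M *ᵥ a - r • a := by
        ext i; simp; ring
      rw [h2]; exact sub_nonneg.2 haM)
    have hsum : ∑ i, a i ≤ (t - r) * ∑ i, x i := by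
      rw [Finset.mul_sum]
      exact Finset.sum_le_sum fun i _ => sub_nonneg.1 (hxa' i)
    have hxpos : 0 < ∑ i, x i :=
      pos_of_mul_pos_right (hapos.trans_le hsum) (sub_pos.2 ht).le
    refine ⟨(∑ i, x i)⁻¹ • x, ⟨fun i => ?_, ?_⟩, fun i => ?_⟩
    · exact mul_nonneg (inv_nonneg.2 hxpos.le) (hx0 i)
    · simp only [Pi.smul_apply, smul_eq_mul, ← Finset.mul_sum]
      exact inv_mul_cancel₀ hxpos.ne'
    · have h1 : t * ((∑ i, x i)⁻¹ • x) i - (M *ᵥ ((∑ i, x i)⁻¹ • x)) i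
          = (∑ i, x i)⁻¹ * a i := by
        rw [← hxa, Matrix.mulVec_smul]; simp; ring
      rw [h1, abs_of_nonneg (mul_nonneg (inv_nonneg.2 hxpos.le) (ha0 i)), ← mul_div_assoc,
        le_div_iff₀ hapos, mul_right_comm, ← div_eq_inv_mul]
      exact mul_le_mul_of_nonneg_right ((div_le_iff₀ hxpos).2 hsum) (ha0 i)
  have hstep : ∀ n : ℕ, r < r + 1 / ((n : ℝ) + 1) := fun n =>
    lt_add_of_pos_right r Nat.one_div_pos_of_nat
  choose y hy hyb using fun n : ℕ => key _ (hstep n)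
  obtain ⟨v, hv, φ, hφ, hlim⟩ := (isCompact_stdSimplex ℝ m).tendsto_subseq hy
  have hφ0 : Tendsto (fun n : ℕ => 1 / ((φ n : ℝ) + 1)) atTop (𝓝 0) :=
    tendsto_one_div_add_atTop_nhds_zero_nat.comp hφ.tendsto_atTop
  refine ⟨v, hv.1, ?_, ?_⟩
  · rintro rfl
    simpa using hv.2
  · ext i
    have hcoord : ∀ j, Tendsto (fun n => y (φ n) j) atTop (𝓝 (v j)) := fun j =>
      (tendsto_pi_nhds.1 hlim) j
    have hMv : Tendsto (fun n => (M *ᵥ y (φ n)) i) atTop (𝓝 ((M *ᵥ v) i)) :=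
      tendsto_finsetSum _ fun j _ => (hcoord j).const_mul (M i j)
    have hl : Tendsto (fun n => (r + 1 / ((φ n : ℝ) + 1)) * y (φ n) i - (M *ᵥ y (φ n)) i) atTop
        (𝓝 ((r + 0) * v i - (M *ᵥ v) i)) :=
      ((tendsto_const_nhds.add hφ0).mul (hcoord i)).sub hMv
    have hz0 : Tendsto (fun n => (r + 1 / ((φ n : ℝ) + 1)) * y (φ n) i - (M *ᵥ y (φ n)) i) atTop
        (𝓝 0) := by
      refine squeeze_zero_norm (fun n => hyb (φ n) i) ?_
      simpa using hφ0.mul_const (a i / ∑ i, a i)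
    have := tendsto_nhds_unique hl hz0
    simp only [add_zero] at this
    rw [Pi.smul_apply, smul_eq_mul]
    linarith

end WeakPerronFrobenius

/-! ### Eigenvectors of algebraically simple eigenvalues. -/

section SimpleEigenvalues

variable {m : Type*} [Fintype m] [DecidableEq m]

theorem finrank_maxGenEigenspace_toLin' (A : Matrix m m ℂ) (z : ℂ) :
    Module.finrank ℂ (Module.End.maxGenEigenspace (Matrix.toLin' A) z)
      = A.charpoly.rootMultiplicity z := by
  rw [LinearMap.finrank_maxGenEigenspace_eq, Matrix.charpoly_toLin']

/-- The generalized eigenspace has dimension equal to the algebraic multiplicity. Allowing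
generalized eigenvectors `y` is what later rules out Jordan chains. -/
theorem exists_smul_eq_of_simple {A : Matrix m m ℂ} {z : ℂ}
    (hz : A.charpoly.rootMultiplicity z = 1) {v y : m → ℂ} (hv : v ≠ 0) (hAv : A *ᵥ v = z • v)
    (hy : y ∈ Module.End.maxGenEigenspace (Matrix.toLin' A) z) : ∃ c : ℂ, c • v = y := by
  have hv' : v ∈ Module.End.maxGenEigenspace (Matrix.toLin' A) z := by
    rw [Module.End.mem_maxGenEigenspace]
    exact ⟨1, by simp [hAv]⟩
  have hfin := (finrank_maxGenEigenspace_toLin' A z).trans hz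
  obtain ⟨c, hc⟩ := (finrank_eq_one_iff_of_nonzero' (⟨v, hv'⟩ : Module.End.maxGenEigenspace
    (Matrix.toLin' A) z) (fun h => hv (congrArg Subtype.val h))).1 hfin ⟨y, hy⟩
  exact ⟨c, congrArg Subtype.val hc⟩

/-- The eigenvectors of an algebraically simple eigenvalue are unique up to scaling. -/
theorem exists_smul_eq_of_mulVec_eq {A : Matrix m m ℂ} {z : ℂ}
    (hz : A.charpoly.rootMultiplicity z = 1) {v y : m → ℂ} (hv : v ≠ 0) (hAv : A *ᵥ v = z • v)
    (hy : A *ᵥ y = z • y) : ∃ c : ℂ, c • v = y :=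
  exists_smul_eq_of_simple hz hv hAv (by
    rw [Module.End.mem_maxGenEigenspace]
    exact ⟨1, by simp [hy]⟩)

/-- An algebraically simple eigenvalue has a right and a left eigenvector that pair to `1`. -/
theorem exists_normalized_eigenvectors {A : Matrix m m ℂ} {z : ℂ}
    (hz : A.charpoly.rootMultiplicity z = 1) :
    ∃ v w : m → ℂ, A *ᵥ v = z • v ∧ w ᵥ* A = z • w ∧ w ⬝ᵥ v = 1 := by
  have hroot : A.charpoly.IsRoot z :=
    (Polynomial.rootMultiplicity_pos (Matrix.charpoly_monic A).ne_zero).1 (hz ▸ one_pos)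
  obtain ⟨v, hv, hAv⟩ := exists_eigenvector_of_isRoot_charpoly hroot
  set f : (m → ℂ) →ₗ[ℂ] (m → ℂ) := Matrix.toLin' A - z • 1 with hf
  have hfv : f v = 0 := by simp [hf, hAv]
  -- If `f y = v`, then `f (f y) = 0`, so `y` is a multiple of `v` and `f y = 0`. A functional
  -- vanishing on the range of `f` but not at `v` is then the left eigenvector.
  have hnot : v ∉ LinearMap.range f := by
    rintro ⟨y, hy⟩
    have hymem : y ∈ Module.End.maxGenEigenspace (Matrix.toLin' A) z := by
      rw [Module.End.mem_maxGenEigenspace]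
      exact ⟨2, by rw [← hf, pow_two, Module.End.mul_apply, hy, hfv]⟩
    obtain ⟨c, rfl⟩ := exists_smul_eq_of_simple hz hv hAv hymem
    rw [map_smul, hfv, smul_zero] at hy
    exact hv hy.symm
  obtain ⟨g, hgv, hg⟩ := Submodule.exists_le_ker_of_notMem hnot
  set w : m → ℂ := fun i => g (Pi.single i 1) with hw
  have hgw : ∀ y, g y = w ⬝ᵥ y := fun y => by
    conv_lhs => rw [pi_eq_sum_univ' y]
    simp [dotProduct, hw, mul_comm]
  refine ⟨v, (g v)⁻¹ • w, hAv, ?_, ?_⟩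
  · rw [Matrix.smul_vecMul, smul_comm]
    congr 1
    have h1 : ∀ y, (w ᵥ* A) ⬝ᵥ y = (z • w) ⬝ᵥ y := fun y => by
      have h2 : g (f y) = 0 := hg ⟨y, rfl⟩
      rw [hgw] at h2
      rw [← Matrix.dotProduct_mulVec, smul_dotProduct, ← dotProduct_smul, ← sub_eq_zero,
        ← dotProduct_sub]
      simpa [hf] using h2
    exact (dotProduct_eq _ _ h1)
  · rw [smul_dotProduct, ← hgw, smul_eq_mul, inv_mul_cancel₀ hgv]

end SimpleEigenvalues

/-! ### Eigenvalues of maximal modulus and their rotational symmetry. -/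

section PeripheralSpectrum

theorem map_ofReal_mulVec {m : Type*} [Fintype m] (M : Matrix m m ℝ) (v : m → ℝ) :
    (M.map Complex.ofReal) *ᵥ (fun i => (v i : ℂ)) = fun i => ((M *ᵥ v) i : ℂ) := by
  ext i; simp [Matrix.mulVec, dotProduct]

/-- The equality case of the triangle inequality. -/
theorem norm_mul_eq_mul_norm_of_norm_sum_eq {ι : Type*} [Fintype ι] {f : ι → ℂ}
    (h : ‖∑ i, f i‖ = ∑ i, ‖f i‖) (j : ι) :
    (‖∑ i, f i‖ : ℂ) * f j = (∑ i, f i) * ‖f j‖ := by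
  set S := ∑ i, f i with hS
  by_cases hS0 : S = 0
  · simp [hS0]
  have hre : ∀ i, (starRingEnd ℂ S * f i).re ≤ ‖S‖ * ‖f i‖ := fun i => by
    refine (Complex.re_le_norm _).trans (le_of_eq ?_)
    rw [norm_mul, Complex.norm_conj]
  have hsum : ∑ i, (starRingEnd ℂ S * f i).re = ∑ i, ‖S‖ * ‖f i‖ := by
    rw [← Complex.re_sum, ← Finset.mul_sum, ← Finset.mul_sum, ← h, ← hS, mul_comm,
      Complex.mul_conj, Complex.ofReal_re, Complex.normSq_eq_norm_sq, sq]
  -- Equality of the sums forces equality in each `re ≤ norm`, so every `conj S * f j` is real and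
  -- nonnegative.
  have heq := (Finset.sum_eq_sum_iff_of_le fun i _ => hre i).1 hsum j (Finset.mem_univ j)
  have hnorm : ‖S‖ * ‖f j‖ = ‖starRingEnd ℂ S * f j‖ := by rw [norm_mul, Complex.norm_conj]
  have h1 : starRingEnd ℂ S * f j = (‖S‖ * ‖f j‖ : ℝ) := by
    have h2 : 0 ≤ starRingEnd ℂ S * f j := Complex.re_eq_norm.1 (heq.trans hnorm)
    rw [← heq]
    exact Complex.ext rfl (by simpa using (Complex.le_def.1 h2).2.symm)
  have h3 : S * starRingEnd ℂ S = (‖S‖ : ℂ) * ‖S‖ := by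
    rw [Complex.mul_conj, Complex.normSq_eq_norm_sq]; push_cast; ring
  have hSn : (‖S‖ : ℂ) ≠ 0 := by exact_mod_cast norm_ne_zero_iff.2 hS0
  apply mul_left_cancel₀ hSn
  rw [← mul_assoc, ← h3, mul_assoc, h1]
  push_cast; ring

variable {m : Type*} [Fintype m] [DecidableEq m]

/-- An eigenvector of maximal absolute value of a nonnegative matrix with positive
Perron--Frobenius eigenvectors conjugates the matrix into a multiple of itself. -/
theorem exists_diagonal_conjugation {M : Matrix m m ℝ} (hM : ∀ i j, 0 ≤ M i j) {r : ℝ} (hr : 0 < r)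
    (hsimple : (M.map Complex.ofReal).charpoly.rootMultiplicity (r : ℂ) = 1)
    {v w : m → ℝ} (hv : ∀ i, 0 < v i) (hw : ∀ i, 0 < w i)
    (hMv : M *ᵥ v = r • v) (hwM : w ᵥ* M = r • w)
    {z : ℂ} (hzr : ‖z‖ = r) (hz : (M.map Complex.ofReal).charpoly.IsRoot z) :
    ∃ s : m → ℂ, (∀ i, s i ≠ 0) ∧ ∀ i j, (M i j : ℂ) * s j = z / r * s i * M i j := by
  obtain ⟨u, hu, huz⟩ := exists_eigenvector_of_isRoot_charpoly hz
  set a : m → ℝ := fun i => ‖u i‖ with ha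
  have hle : r • a ≤ M *ᵥ a := hzr ▸ smul_norm_le_mulVec_norm hM huz
  -- Both sides of `r a ≤ M a` have the same pairing with the strictly positive left eigenvector
  -- `w`, so the inequality is an equality. Simplicity then makes `a` a multiple of `v`, and no
  -- entry of `u` vanishes.
  have hMa : M *ᵥ a = r • a := by
    have h1 : ∑ i, w i * (r • a) i = ∑ i, w i * (M *ᵥ a) i := by
      change w ⬝ᵥ (r • a) = w ⬝ᵥ (M *ᵥ a)
      rw [Matrix.dotProduct_mulVec, hwM, dotProduct_smul, smul_dotProduct]
    have h2 := (Finset.sum_eq_sum_iff_of_le fun i _ =>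
      mul_le_mul_of_nonneg_left (hle i) (hw i).le).1 h1
    ext i
    exact (mul_left_cancel₀ (hw i).ne' (h2 i (Finset.mem_univ i))).symm
  obtain ⟨i₀, hi₀⟩ := Function.ne_iff.1 hu
  have hvc : (fun i => (v i : ℂ)) ≠ 0 := fun h => by
    have := congrFun h i₀
    exact (hv i₀).ne' (by simpa using this)
  obtain ⟨c, hc⟩ := exists_smul_eq_of_mulVec_eq hsimple hvc
    (y := fun i => (a i : ℂ))
    (by rw [map_ofReal_mulVec, hMv]; ext i; simp) (by rw [map_ofReal_mulVec, hMa]; ext i; simp)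
  have hc0 : c ≠ 0 := by
    rintro rfl
    have := congrFun hc i₀
    exact hi₀ (by simpa [ha] using this.symm)
  have hu0 : ∀ i, u i ≠ 0 := fun i hi => by
    have := congrFun hc i
    simp [ha, hi, hc0, (hv i).ne'] at this
  have hn0 : ∀ i, (‖u i‖ : ℂ) ≠ 0 := fun i => by exact_mod_cast norm_ne_zero_iff.2 (hu0 i)
  have hr0 : (r : ℂ) ≠ 0 := by exact_mod_cast hr.ne'
  -- The conjugating diagonal consists of the phases of `u`; the relation is the equality case of
  -- the triangle inequality in row `i` of `M u = z u`.
  refine ⟨fun i => u i / ‖u i‖, fun i => div_ne_zero (hu0 i) (hn0 i), fun i j => ?_⟩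
  have hsum : ∑ j, (M i j : ℂ) * u j = z * u i := congrFun huz i
  have hnorm : ∀ j, ‖(M i j : ℂ) * u j‖ = M i j * ‖u j‖ := fun j => by
    rw [norm_mul, Complex.norm_real, Real.norm_of_nonneg (hM i j)]
  have htri := norm_mul_eq_mul_norm_of_norm_sum_eq (f := fun j => (M i j : ℂ) * u j) (by
    simp only [hsum, hnorm, norm_mul, hzr]
    exact (congrFun hMa i).symm) j
  simp only [hsum, hnorm, norm_mul, hzr] at htri
  push_cast at htri
  have hui := hn0 i
  have huj := hn0 j
  field_simp
  linear_combination htri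

/-- With `D = diagonal s` the hypothesis reads `A D = c D A`, so `(c t - A) D = D (c (t - A))`; take
determinants and cancel `det D`. -/
theorem eval_mul_charpoly_of_conjugation {A : Matrix m m ℂ} {c : ℂ} {s : m → ℂ}
    (hs : ∀ i, s i ≠ 0) (h : ∀ i j, A i j * s j = c * s i * A i j) (t : ℂ) :
    A.charpoly.eval (c * t) = c ^ Fintype.card m * A.charpoly.eval t := by
  rw [Matrix.eval_charpoly, Matrix.eval_charpoly]
  have hmat : (Matrix.scalar m (c * t) - A) * Matrix.diagonal s
      = Matrix.diagonal s * (c • (Matrix.scalar m t - A)) := by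
    ext i j
    rw [Matrix.mul_diagonal, Matrix.diagonal_mul]
    by_cases hij : i = j
    · subst hij
      simp only [Matrix.sub_apply, Matrix.smul_apply, Matrix.scalar_apply, Matrix.diagonal_apply_eq,
        smul_eq_mul]
      linear_combination -(h i i)
    · simp only [Matrix.sub_apply, Matrix.smul_apply, Matrix.scalar_apply,
        Matrix.diagonal_apply_ne _ hij, smul_eq_mul]
      linear_combination -(h i j)
  have hdet := congrArg Matrix.det hmat
  rw [Matrix.det_mul, Matrix.det_mul, Matrix.det_smul, Matrix.det_diagonal, mul_comm] at hdet
  exact mul_left_cancel₀ (Finset.prod_ne_zero_iff.2 fun i _ => hs i) hdet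

theorem rootMultiplicity_eq_one_iff {p : ℂ[X]} (hp : p ≠ 0) (z : ℂ) :
    p.rootMultiplicity z = 1 ↔ p.IsRoot z ∧ ¬ p.derivative.IsRoot z := by
  have h1 := Polynomial.rootMultiplicity_pos hp (x := z)
  have h2 := Polynomial.one_lt_rootMultiplicity_iff_isRoot hp (t := z)
  constructor
  · intro h
    have hr := h1.1 (by omega)
    exact ⟨hr, fun hd => by have := h2.2 ⟨hr, hd⟩; omega⟩
  · rintro ⟨hr, hd⟩
    have := h1.2 hr
    have : ¬ 1 < p.rootMultiplicity z := fun h => hd (h2.1 h).2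
    omega

/-- Differentiating `p (c t) = d p t` gives `c p' (c z) = d p' z`, so a simple root stays simple
under multiplication by `c`. -/
theorem rootMultiplicity_mul_eq_one {p : ℂ[X]} (hp : p ≠ 0) {c d : ℂ} (hd : d ≠ 0)
    (h : ∀ t, p.eval (c * t) = d * p.eval t) {z : ℂ} (hz : p.rootMultiplicity z = 1) :
    p.rootMultiplicity (c * z) = 1 := by
  have hcomp : p.comp (C c * X) = C d * p := Polynomial.funext fun t => by simp [h]
  have hder := congrArg (fun q => (derivative q).eval z) hcomp
  simp only [derivative_comp, derivative_C_mul, derivative_X, eval_mul, eval_C, eval_comp, mul_one,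
    eval_X] at hder
  rw [rootMultiplicity_eq_one_iff hp] at hz ⊢
  refine ⟨by rw [IsRoot, h, hz.1.eq_zero, mul_zero], fun h0 => hz.2 ?_⟩
  rw [IsRoot] at h0 ⊢
  rw [h0, mul_zero] at hder
  exact (mul_eq_zero.1 hder.symm).resolve_left hd

theorem charpoly_eq_mul_of_twoBlockTriangular (A : Matrix m m ℂ) (p : m → Prop) [DecidablePred p]
    (h : ∀ i, ¬ p i → ∀ j, p j → A i j = 0) :
    A.charpoly = (A.toSquareBlockProp p).charpoly
      * (A.toSquareBlockProp fun i => ¬ p i).charpoly := by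
  rw [Matrix.charpoly, Matrix.twoBlockTriangular_det _ p]
  · congr 2 <;> ext i j : 2 <;>
      simp [Matrix.toSquareBlockProp, Matrix.charmatrix_apply, Matrix.diagonal_apply,
        Subtype.ext_iff]
  · intro i hi j hj
    rw [Matrix.charmatrix_apply_ne _ _ _ (by rintro rfl; exact hi hj), h i hi j hj]
    simp

/-- By weak Perron–Frobenius, a block with any eigenvalue of modulus `r` has `r` itself as an
eigenvalue. A block without `r` therefore contributes nothing on the circle of radius `r`, and the
claim passes from `P` to the product. -/
theorem rootMultiplicity_mul_charpoly_eq_one {M : Matrix m m ℝ} (hM : ∀ i j, 0 ≤ M i j) {r : ℝ}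
    (hr0 : 0 < r) (hr : ∀ z, (M.map Complex.ofReal).charpoly.IsRoot z → ‖z‖ ≤ r)
    (hnot : ¬ (M.map Complex.ofReal).charpoly.IsRoot (r : ℂ)) {P : ℂ[X]} (hP0 : P ≠ 0)
    (hP : ∀ z z', P.IsRoot z → ‖z‖ = r → P.IsRoot z' → ‖z'‖ = r →
      P.rootMultiplicity (z / r * z') = 1) {z z' : ℂ}
    (hz : (P * (M.map Complex.ofReal).charpoly).IsRoot z) (hzr : ‖z‖ = r)
    (hz' : (P * (M.map Complex.ofReal).charpoly).IsRoot z') (hzr' : ‖z'‖ = r) :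
    (P * (M.map Complex.ofReal).charpoly).rootMultiplicity (z / r * z') = 1 := by
  have hQ0 := (Matrix.charpoly_monic (M.map Complex.ofReal)).ne_zero
  have hno : ∀ y : ℂ, ‖y‖ = r → ¬ (M.map Complex.ofReal).charpoly.IsRoot y := fun y hy hyr => by
    obtain ⟨v, -, hv, hMv⟩ := exists_nonneg_eigenvector hM hr hyr hy
    exact hnot ((isRoot_map_ofReal_charpoly_iff M r).2 (isRoot_charpoly_of_mulVec_eq hv hMv))
  have hnorm : ‖z / r * z'‖ = r := by
    rw [norm_mul, norm_div, hzr, hzr', Complex.norm_real, Real.norm_of_nonneg hr0.le,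
      div_self hr0.ne', one_mul]
  rw [Polynomial.root_mul] at hz hz'
  rw [Polynomial.rootMultiplicity_mul (mul_ne_zero hP0 hQ0),
    hP z z' (hz.resolve_right (hno z hzr)) hzr (hz'.resolve_right (hno z' hzr')) hzr',
    Polynomial.rootMultiplicity_eq_zero (hno _ hnorm)]

/-- The zero set of a nonnegative left or right eigenvector yields a block decomposition, so
irreducibility makes both Perron vectors strictly positive and the diagonal conjugation is
available. -/
theorem rootMultiplicity_peripheral_eq_one_of_irreducible {M : Matrix m m ℝ}
    (hM : ∀ i j, 0 ≤ M i j) {r : ℝ}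
    (hr0 : 0 < r) (hr : ∀ z, (M.map Complex.ofReal).charpoly.IsRoot z → ‖z‖ ≤ r)
    (hsimple : (M.map Complex.ofReal).charpoly.rootMultiplicity (r : ℂ) = 1)
    (hred : ¬ ∃ p : m → Prop, (∃ i, p i) ∧ (∃ i, ¬ p i) ∧ ∀ i, ¬ p i → ∀ j, p j → M i j = 0)
    {z z' : ℂ} (hz : (M.map Complex.ofReal).charpoly.IsRoot z) (hzr : ‖z‖ = r)
    (hz' : (M.map Complex.ofReal).charpoly.IsRoot z') (hzr' : ‖z'‖ = r) :
    (M.map Complex.ofReal).charpoly.rootMultiplicity (z / r * z') = 1 := by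
  have hne : (M.map Complex.ofReal).charpoly ≠ 0 := (Matrix.charpoly_monic _).ne_zero
  have hrroot : (M.map Complex.ofReal).charpoly.IsRoot (r : ℂ) :=
    (Polynomial.rootMultiplicity_pos hne).1 (hsimple ▸ one_pos)
  have hrn : ‖(r : ℂ)‖ = r := by rw [Complex.norm_real, Real.norm_of_nonneg hr0.le]
  obtain ⟨v, hv0, hvne, hMv⟩ := exists_nonneg_eigenvector hM hr hrroot hrn
  have htr : (Mᵀ.map Complex.ofReal).charpoly = (M.map Complex.ofReal).charpoly := by
    rw [Matrix.transpose_map, Matrix.charpoly_transpose]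
  obtain ⟨w, hw0, hwne, hMw⟩ := exists_nonneg_eigenvector (M := Mᵀ) (fun i j => hM j i)
    (by rwa [htr]) (by rwa [htr]) hrn
  have hvpos : ∀ i, 0 < v i := by
    by_contra hcon
    push Not at hcon
    obtain ⟨i, hi⟩ := hcon
    obtain ⟨i', hi'⟩ := Function.ne_iff.1 hvne
    refine hred ⟨fun i => v i ≠ 0, ⟨i', hi'⟩, ⟨i, not_not.2 (le_antisymm hi (hv0 i))⟩,
      fun k hk j hj => ?_⟩
    have hsum : ∑ j, M k j * v j = 0 := by
      have := congrFun hMv k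
      rw [Pi.smul_apply, not_not.1 hk, smul_zero] at this
      exact this
    exact (mul_eq_zero.1 ((Finset.sum_eq_zero_iff_of_nonneg fun j _ =>
      mul_nonneg (hM k j) (hv0 j)).1 hsum j (Finset.mem_univ j))).resolve_right hj
  have hwpos : ∀ i, 0 < w i := by
    by_contra hcon
    push Not at hcon
    obtain ⟨i, hi⟩ := hcon
    obtain ⟨i', hi'⟩ := Function.ne_iff.1 hwne
    refine hred ⟨fun i => w i = 0, ⟨i, le_antisymm hi (hw0 i)⟩, ⟨i', hi'⟩,
      fun k hk j hj => ?_⟩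
    have hsum : ∑ k, M k j * w k = 0 := by
      have := congrFun hMw j
      rw [Pi.smul_apply, hj, smul_zero] at this
      exact this
    exact (mul_eq_zero.1 ((Finset.sum_eq_zero_iff_of_nonneg fun k _ =>
      mul_nonneg (hM k j) (hw0 k)).1 hsum k (Finset.mem_univ k))).resolve_right hk
  rw [Matrix.mulVec_transpose] at hMw
  have hrc : (r : ℂ) ≠ 0 := by exact_mod_cast hr0.ne'
  have hmul : ∀ y y' : ℂ, (M.map Complex.ofReal).charpoly.IsRoot y → ‖y‖ = r →
      (M.map Complex.ofReal).charpoly.rootMultiplicity y' = 1 →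
      (M.map Complex.ofReal).charpoly.rootMultiplicity (y / r * y') = 1 := by
    intro y y' hy hyr hy'
    obtain ⟨s, hs, hsM⟩ := exists_diagonal_conjugation hM hr0 hsimple hvpos hwpos hMv hMw hyr hy
    have hy0 : y ≠ 0 := norm_ne_zero_iff.1 (hyr ▸ hr0.ne')
    exact rootMultiplicity_mul_eq_one hne (pow_ne_zero _ (div_ne_zero hy0 hrc))
      (eval_mul_charpoly_of_conjugation hs hsM) hy'
  have h1 := hmul z' r hz' hzr' hsimple
  -- Two rotations of the simple root `r`: the first carries it to `z'`, the second carries `z'` to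
  -- `z / r * z'`.
  rw [div_mul_cancel₀ _ hrc] at h1
  exact hmul z z' hz hzr h1

/-- If the spectral radius `r > 0` of a nonnegative matrix is a simple eigenvalue, then all
eigenvalues of absolute value `r` are simple, and after division by `r` they are closed under
multiplication. -/
theorem rootMultiplicity_peripheral_eq_one {M : Matrix m m ℝ} (hM : ∀ i j, 0 ≤ M i j) {r : ℝ}
    (hr0 : 0 < r) (hr : ∀ z, (M.map Complex.ofReal).charpoly.IsRoot z → ‖z‖ ≤ r)
    (hsimple : (M.map Complex.ofReal).charpoly.rootMultiplicity (r : ℂ) = 1) {z z' : ℂ}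
    (hz : (M.map Complex.ofReal).charpoly.IsRoot z) (hzr : ‖z‖ = r)
    (hz' : (M.map Complex.ofReal).charpoly.IsRoot z') (hzr' : ‖z'‖ = r) :
    (M.map Complex.ofReal).charpoly.rootMultiplicity (z / r * z') = 1 := by
  classical
  induction hcard : Fintype.card m using Nat.strong_induction_on generalizing m z z' with
  | _ N ih =>
  by_cases hred : ∃ p : m → Prop, (∃ i, p i) ∧ (∃ i, ¬ p i) ∧ ∀ i, ¬ p i → ∀ j, p j → M i j = 0
  · obtain ⟨p, ⟨i₁, hi₁⟩, ⟨i₂, hi₂⟩, hblock⟩ := hred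
    have hfac := charpoly_eq_mul_of_twoBlockTriangular (M.map Complex.ofReal) p
      (fun i hi j hj => by rw [Matrix.map_apply, hblock i hi j hj, Complex.ofReal_zero])
    set M₁ := M.toSquareBlockProp p
    set M₂ := M.toSquareBlockProp fun i => ¬ p i
    change (M.map Complex.ofReal).charpoly
      = (M₁.map Complex.ofReal).charpoly * (M₂.map Complex.ofReal).charpoly at hfac
    have hne₁ : (M₁.map Complex.ofReal).charpoly ≠ 0 := (Matrix.charpoly_monic _).ne_zero
    have hne₂ : (M₂.map Complex.ofReal).charpoly ≠ 0 := (Matrix.charpoly_monic _).ne_zero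
    have hM₁ : ∀ i j, 0 ≤ M₁ i j := fun i j => hM _ _
    have hM₂ : ∀ i j, 0 ≤ M₂ i j := fun i j => hM _ _
    have hr₁ : ∀ y, (M₁.map Complex.ofReal).charpoly.IsRoot y → ‖y‖ ≤ r := fun y hy =>
      hr y (by rw [hfac, Polynomial.root_mul]; exact Or.inl hy)
    have hr₂ : ∀ y, (M₂.map Complex.ofReal).charpoly.IsRoot y → ‖y‖ ≤ r := fun y hy =>
      hr y (by rw [hfac, Polynomial.root_mul]; exact Or.inr hy)
    have hc₁ : Fintype.card {i // p i} < N := hcard ▸ Fintype.card_subtype_lt hi₂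
    have hc₂ : Fintype.card {i // ¬ p i} < N :=
      hcard ▸ Fintype.card_subtype_lt (x := i₁) (not_not.2 hi₁)
    rw [hfac, Polynomial.rootMultiplicity_mul (mul_ne_zero hne₁ hne₂)] at hsimple
    rw [hfac] at hz hz' ⊢
    have ih₁ := @ih _ hc₁ _ _ _ M₁ hM₁ hr₁
    have ih₂ := @ih _ hc₂ _ _ _ M₂ hM₂ hr₂
    -- The multiplicities of `r` in the two diagonal blocks add up to one: one block inherits
    -- simplicity and falls to induction, the other does not have `r` as an eigenvalue.
    rcases Nat.add_eq_one_iff.1 hsimple with ⟨h₁, h₂⟩ | ⟨h₁, h₂⟩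
    · have hnot₁ : ¬ (M₁.map Complex.ofReal).charpoly.IsRoot (r : ℂ) := fun h =>
        hne₁ (Polynomial.rootMultiplicity_eq_zero_iff.1 h₁ h)
      rw [mul_comm (M₁.map Complex.ofReal).charpoly] at hz hz' ⊢
      exact rootMultiplicity_mul_charpoly_eq_one hM₁ hr0 hr₁ hnot₁ hne₂
        (fun y y' hy hyr hy' hyr' => ih₂ h₂ hy hyr hy' hyr' rfl)
        hz hzr hz' hzr'
    · have hnot₂ : ¬ (M₂.map Complex.ofReal).charpoly.IsRoot (r : ℂ) := fun h =>
        hne₂ (Polynomial.rootMultiplicity_eq_zero_iff.1 h₂ h)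
      exact rootMultiplicity_mul_charpoly_eq_one hM₂ hr0 hr₂ hnot₂ hne₁
        (fun y y' hy hyr hy' hyr' => ih₁ h₁ hy hyr hy' hyr' rfl)
        hz hzr hz' hzr'
  · exact rootMultiplicity_peripheral_eq_one_of_irreducible hM hr0 hr hsimple hred hz hzr hz' hzr'

/-- A finite set of nonzero complex numbers that contains `1` and is closed under multiplication
consists of the `h`-th roots of unity for some `h`. -/
theorem exists_bijOn_zeta_pow {S : Set ℂ} (hfin : S.Finite) (h1 : 1 ∈ S) (h0 : ∀ z ∈ S, z ≠ 0)
    (hmul : ∀ z ∈ S, ∀ z' ∈ S, z * z' ∈ S) :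
    ∃ h : ℕ, 1 ≤ h ∧ Set.BijOn (fun k : ℕ => zeta h ^ k) (Set.Iio h) S := by
  classical
  set h := hfin.toFinset.card with hh
  have hpos : 1 ≤ h := Finset.card_pos.2 ⟨1, by simpa using h1⟩
  have : NeZero h := ⟨by omega⟩
  have hprim : IsPrimitiveRoot (zeta h) h := Complex.isPrimitiveRoot_exp h (by omega)
  have hpow : ∀ z ∈ S, z ^ h = 1 := by
    intro z hz
    -- Multiplication by `z` permutes `S`, so comparing the products of all elements gives `z ^ h =
    -- 1` with `h = |S|`. There are only `h` such roots of unity, so `S` contains all of them.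
    have himage : hfin.toFinset.image (z * ·) = hfin.toFinset := by
      refine Finset.eq_of_subset_of_card_le ?_ ?_
      · intro y hy
        obtain ⟨x, hx, rfl⟩ := Finset.mem_image.1 hy
        rw [Set.Finite.mem_toFinset] at hx ⊢
        exact hmul z hz x hx
      · rw [Finset.card_image_of_injective _ (mul_right_injective₀ (h0 z hz))]
    have hprod : ∏ y ∈ hfin.toFinset, y = z ^ h * ∏ y ∈ hfin.toFinset, y := by
      conv_lhs => rw [← himage]
      rw [Finset.prod_image (fun a _ b _ hab => mul_right_injective₀ (h0 z hz) hab),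
        Finset.prod_mul_distrib, Finset.prod_const]
    have hne : ∏ y ∈ hfin.toFinset, y ≠ 0 :=
      Finset.prod_ne_zero_iff.2 fun y hy => h0 y (by simpa using hy)
    exact mul_right_cancel₀ hne (by rw [← hprod, one_mul])
  have hinj : Set.InjOn (fun k : ℕ => zeta h ^ k) (Set.Iio h) := fun a ha b hb hab =>
    hprim.pow_inj ha hb hab
  have hsub : hfin.toFinset ⊆ (Finset.range h).image (fun k => zeta h ^ k) := by
    intro z hz
    obtain ⟨k, hk, rfl⟩ := hprim.eq_pow_of_pow_eq_one (hpow z (by simpa using hz))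
    exact Finset.mem_image.2 ⟨k, Finset.mem_range.2 hk, rfl⟩
  have heq : hfin.toFinset = (Finset.range h).image (fun k => zeta h ^ k) :=
    Finset.eq_of_subset_of_card_le hsub (Finset.card_image_le.trans (by simp [hh]))
  refine ⟨h, hpos, fun k hk => ?_, hinj, fun z hz => ?_⟩
  · have : zeta h ^ k ∈ hfin.toFinset := heq ▸ Finset.mem_image_of_mem _ (Finset.mem_range.2 hk)
    simpa using this
  · obtain ⟨k, hk, rfl⟩ := Finset.mem_image.1 (heq ▸ hfin.mem_toFinset.2 hz)
    exact ⟨k, Finset.mem_range.1 hk, rfl⟩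

end PeripheralSpectrum

/-! ### Splitting off the spectral projections of simple eigenvalues. -/

section SpectralDecomposition

variable {m κ : Type*} [Fintype m] [DecidableEq m] [Fintype κ]

/-- The powers of a matrix are determined, up to an error governed by the remaining eigenvalues,
by the spectral projections onto a set of simple eigenvalues. -/
theorem exists_norm_pow_sub_sum_le (A : Matrix m m ℂ) {μ : κ → ℂ} (hμ : Function.Injective μ)
    (hsimple : ∀ k, A.charpoly.rootMultiplicity (μ k) = 1) {v w : κ → m → ℂ}
    (hv : ∀ k, A *ᵥ v k = μ k • v k) (hw : ∀ k, w k ᵥ* A = μ k • w k)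
    (hwv : ∀ k, w k ⬝ᵥ v k = 1) {σ ρ : ℝ} (hσ0 : 0 ≤ σ) (hσ : σ < ρ)
    (hroot : ∀ z, A.charpoly.IsRoot z → z ∉ Set.range μ → ‖z‖ ≤ σ) :
    ∃ B, ∀ (n : ℕ) (i j : m), ‖(A ^ n) i j - ∑ k, μ k ^ n * (v k i * w k j)‖ ≤ B * ρ ^ n := by
  classical
  have hρ : 0 < ρ := hσ0.trans_lt hσ
  have horth : ∀ k l, k ≠ l → w k ⬝ᵥ v l = 0 := by
    intro k l hkl
    have h1 : μ k * (w k ⬝ᵥ v l) = μ l * (w k ⬝ᵥ v l) := by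
      rw [← smul_eq_mul, ← smul_eq_mul, ← smul_dotProduct, ← hw, ← Matrix.dotProduct_mulVec, hv,
        dotProduct_smul]
    have h2 : (μ k - μ l) * (w k ⬝ᵥ v l) = 0 := by rw [sub_mul, h1, sub_self]
    exact (mul_eq_zero.1 h2).resolve_left (sub_ne_zero.2 fun h => hkl (hμ h))
  set P : κ → Matrix m m ℂ := fun k => vecMulVec (v k) (w k) with hP
  have hPP : ∀ k l, P k * P l = if k = l then P k else 0 := by
    intro k l
    simp only [hP, vecMulVec_mul_vecMulVec]
    split_ifs with hkl
    · subst hkl; rw [hwv, one_smul]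
    · rw [horth k l hkl, zero_smul, vecMulVec_zero]
  have hAP : ∀ k, A * P k = μ k • P k := fun k => by
    simp only [hP, mul_vecMulVec, hv, smul_vecMulVec]
  have hPA : ∀ k, P k * A = μ k • P k := fun k => by
    simp only [hP, vecMulVec_mul, hw, vecMulVec_smul]
  have hApow : ∀ (n : ℕ) k, A ^ n * P k = μ k ^ n • P k := by
    intro n k
    induction n with
    | zero => simp
    | succ n ih => rw [pow_succ', mul_assoc, ih, mul_smul_comm, hAP, smul_smul, pow_succ]
  -- The complementary projection. It commutes with `A`, so `A ^ n` splits into the explicit sum and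
  -- `(A * Q) ^ n * Q`.
  set Q : Matrix m m ℂ := 1 - ∑ k, P k with hQ
  have hPQ : ∀ k, P k * Q = 0 := fun k => by
    rw [hQ, mul_sub, mul_one, Finset.mul_sum]
    simp [hPP]
  have hQQ : Q * Q = Q := by
    conv_lhs => enter [1]; rw [hQ]
    rw [sub_mul, one_mul, Finset.sum_mul]
    simp [hPQ]
  have hAQ : Commute A Q := by
    rw [Commute, SemiconjBy, hQ, mul_sub, sub_mul, mul_one, one_mul, Finset.mul_sum, Finset.sum_mul]
    simp [hAP, hPA]
  have hpow : ∀ n : ℕ, A ^ n = ∑ k, μ k ^ n • P k + (A * Q) ^ n * Q := by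
    intro n
    have h1 : (A * Q) ^ n * Q = A ^ n * Q := by
      have hid : IsIdempotentElem Q := hQQ
      rw [hAQ.mul_pow, mul_assoc, ← pow_succ, hid.pow_succ_eq n]
    rw [h1, hQ, mul_sub, mul_one, Finset.mul_sum]
    simp [hApow]
  -- An eigenvector of `A * Q` for `z ≠ 0` is killed by every `P k`, so it is an eigenvector of `A`.
  -- If `z = μ k`, simplicity would make it a multiple of `v k`, which `P k` fixes.
  have hN : ∀ z, (A * Q).charpoly.IsRoot z → ‖z‖ ≤ σ := by
    intro z hz
    by_cases hz0 : z = 0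
    · simpa [hz0] using hσ0
    obtain ⟨y, hy0, hy⟩ := exists_eigenvector_of_isRoot_charpoly hz
    have hPy : ∀ k, P k *ᵥ y = 0 := fun k => by
      have h1 : z • (P k *ᵥ y) = 0 := by
        rw [← Matrix.mulVec_smul, ← hy, Matrix.mulVec_mulVec, ← mul_assoc, hPA, smul_mul_assoc,
          hPQ, smul_zero, Matrix.zero_mulVec]
      exact (smul_eq_zero.1 h1).resolve_left hz0
    have hQy : Q *ᵥ y = y := by
      rw [hQ, Matrix.sub_mulVec, Matrix.one_mulVec, Matrix.sum_mulVec]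
      simp [hPy]
    rw [← Matrix.mulVec_mulVec, hQy] at hy
    refine hroot z (isRoot_charpoly_of_mulVec_eq hy0 hy) ?_
    rintro ⟨k, rfl⟩
    have hvk : v k ≠ 0 := fun h => by simpa [h] using hwv k
    obtain ⟨c, rfl⟩ := exists_smul_eq_of_mulVec_eq (hsimple k) hvk (hv k) hy
    have h2 := hPy k
    rw [Matrix.mulVec_smul, hP, vecMulVec_mulVec, hwv, MulOpposite.op_one, one_smul] at h2
    exact hy0 h2
  obtain ⟨B, hB⟩ := exists_norm_pow_entry_le (A * Q) hσ hρ hN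
  refine ⟨B * ∑ l, ∑ j, ‖Q l j‖, fun n i j => ?_⟩
  have hentry : (A ^ n) i j - ∑ k, μ k ^ n * (v k i * w k j) = ((A * Q) ^ n * Q) i j := by
    rw [hpow n, Matrix.add_apply, Matrix.sum_apply]
    simp [hP, vecMulVec_apply]
  have hB0 : 0 ≤ B * ρ ^ n := (norm_nonneg _).trans (hB n i j)
  rw [hentry, Matrix.mul_apply]
  calc ‖∑ l, ((A * Q) ^ n) i l * Q l j‖ ≤ ∑ l, ‖((A * Q) ^ n) i l * Q l j‖ := norm_sum_le _ _
    _ ≤ ∑ l, B * ρ ^ n * ∑ j, ‖Q l j‖ := Finset.sum_le_sum fun l _ => by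
        rw [norm_mul]
        exact mul_le_mul (hB n i l) (Finset.single_le_sum (f := fun j => ‖Q l j‖)
          (fun _ _ => norm_nonneg _) (Finset.mem_univ j)) (norm_nonneg _) hB0
    _ = _ := by rw [← Finset.mul_sum]; ring

end SpectralDecomposition

/-! ### The period, the second modulus and the error term. -/

section Period

variable {m : Type*} [Fintype m] [DecidableEq m]

theorem mem_eigenvalues_iff (M : Matrix m m ℝ) (z : ℂ) :
    z ∈ eigenvalues M ↔ (M.map Complex.ofReal).charpoly.IsRoot z :=
  Matrix.mem_spectrum_iff_isRoot_charpoly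

theorem finite_eigenvalues (M : Matrix m m ℝ) : (eigenvalues M).Finite :=
  Matrix.finite_spectrum _

theorem HasPerronFrobeniusProperty.rootMultiplicity_map {M : Matrix m m ℝ}
    (h : HasPerronFrobeniusProperty M) :
    (M.map Complex.ofReal).charpoly.rootMultiplicity (pfEigenvalue M : ℂ) = 1 := by
  rw [map_ofReal_charpoly]
  exact (Polynomial.eq_rootMultiplicity_map (f := Complex.ofRealHom) Complex.ofReal_injective
    (pfEigenvalue M)).symm.trans h

theorem HasPerronFrobeniusProperty.isRoot {M : Matrix m m ℝ} (h : HasPerronFrobeniusProperty M) :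
    (M.map Complex.ofReal).charpoly.IsRoot (pfEigenvalue M : ℂ) :=
  (Polynomial.rootMultiplicity_pos (Matrix.charpoly_monic _).ne_zero).1
    (h.rootMultiplicity_map ▸ one_pos)

theorem norm_pfEigenvalue (M : Matrix m m ℝ) : ‖(pfEigenvalue M : ℂ)‖ = pfEigenvalue M := by
  rw [Complex.norm_real, Real.norm_of_nonneg (pfEigenvalue_nonneg M)]

theorem exists_isPeriod {M : Matrix m m ℝ} (hM : ∀ i j, 0 ≤ M i j)
    (hPF : HasPerronFrobeniusProperty M) : ∃ h, IsPeriod M h := by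
  rcases (pfEigenvalue_nonneg M).eq_or_lt with h0 | hpos
  -- For `λ = 0` the only peripheral eigenvalue is `0`, so `h = 1`.
  · refine ⟨1, le_rfl, fun k hk => ?_, fun a ha b hb _ => ?_, fun z hz =>
      ⟨0, Set.mem_Iio.2 one_pos, ?_⟩⟩
    · have h1 := hPF.isRoot
      simp only [← h0, Complex.ofReal_zero] at h1
      simpa [← h0, mem_eigenvalues_iff] using h1
    · simp only [Set.mem_Iio] at ha hb; omega
    · have := hz.2
      rw [← h0, norm_eq_zero] at this
      simp [← h0, this]
  · have hc : (pfEigenvalue M : ℂ) ≠ 0 := by exact_mod_cast hpos.ne'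
    have hle : ∀ z, (M.map Complex.ofReal).charpoly.IsRoot z → ‖z‖ ≤ pfEigenvalue M :=
      fun z hz => norm_le_pfEigenvalue M hz
    set T := {μ ∈ eigenvalues M | ‖μ‖ = pfEigenvalue M} with hT
    set S := (fun z : ℂ => z / pfEigenvalue M) '' T with hS
    have hTfin : T.Finite := (finite_eigenvalues M).subset fun z hz => hz.1
    obtain ⟨h, hh, hbij⟩ := exists_bijOn_zeta_pow (S := S) (hTfin.image _)
      ⟨pfEigenvalue M, ⟨(mem_eigenvalues_iff _ _).2 hPF.isRoot, norm_pfEigenvalue M⟩, div_self hc⟩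
      (by
        rintro _ ⟨z, hz, rfl⟩
        exact div_ne_zero (norm_ne_zero_iff.1 (hz.2 ▸ hpos.ne')) hc)
      (by
        rintro _ ⟨z, hz, rfl⟩ _ ⟨z', hz', rfl⟩
        have h1 := rootMultiplicity_peripheral_eq_one hM hpos hle hPF.rootMultiplicity_map
          ((mem_eigenvalues_iff _ _).1 hz.1) hz.2 ((mem_eigenvalues_iff _ _).1 hz'.1) hz'.2
        refine ⟨z / pfEigenvalue M * z', ⟨(mem_eigenvalues_iff _ _).2 ?_, ?_⟩, ?_⟩
        · exact (Polynomial.rootMultiplicity_pos (Matrix.charpoly_monic _).ne_zero).1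
            (h1 ▸ one_pos)
        · rw [norm_mul, norm_div, norm_pfEigenvalue, hz.2, hz'.2, div_self hpos.ne', one_mul]
        · simp only [mul_div_assoc])
    refine ⟨h, hh, ?_⟩
    have hbij' : Set.BijOn (fun z : ℂ => z * pfEigenvalue M) S T := by
      refine ⟨?_, (mul_left_injective₀ hc).injOn, ?_⟩
      · rintro _ ⟨z, hz, rfl⟩
        simpa only [div_mul_cancel₀ _ hc] using hz
      · intro z hz
        exact ⟨z / pfEigenvalue M, ⟨z, hz, rfl⟩, div_mul_cancel₀ _ hc⟩
    exact hbij'.comp hbij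

theorem IsPeriod.rootMultiplicity_eq_one {M : Matrix m m ℝ} (hM : ∀ i j, 0 ≤ M i j)
    (hPF : HasPerronFrobeniusProperty M) {h : ℕ} (hh : IsPeriod M h) (k : Fin h) :
    (M.map Complex.ofReal).charpoly.rootMultiplicity (zeta h ^ (k : ℕ) * (pfEigenvalue M : ℂ))
      = 1 := by
  rcases (pfEigenvalue_nonneg M).eq_or_lt with h0 | hpos
  · have h1 := hPF.rootMultiplicity_map
    simpa [← h0] using h1
  · have hc : (pfEigenvalue M : ℂ) ≠ 0 := by exact_mod_cast hpos.ne'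
    have hmem := hh.2.mapsTo (Set.mem_Iio.2 k.2)
    have h1 := rootMultiplicity_peripheral_eq_one hM hpos (fun z hz => norm_le_pfEigenvalue M hz)
      hPF.rootMultiplicity_map ((mem_eigenvalues_iff _ _).1 hmem.1) hmem.2 hPF.isRoot
      (norm_pfEigenvalue M)
    rwa [div_mul_cancel₀ _ hc] at h1

theorem IsPeriod.exists_isNormalizedEigensystem {M : Matrix m m ℝ} (hM : ∀ i j, 0 ≤ M i j)
    (hPF : HasPerronFrobeniusProperty M) {h : ℕ} (hh : IsPeriod M h) :
    ∃ v w : Fin h → m → ℂ, IsNormalizedEigensystem M v w := by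
  choose v w hvw using fun k : Fin h =>
    exists_normalized_eigenvectors (hh.rootMultiplicity_eq_one hM hPF k)
  exact ⟨v, w, hvw⟩

theorem norm_zeta (h : ℕ) : ‖zeta h‖ = 1 := by
  have : zeta h = Complex.exp ((2 * Real.pi / h : ℝ) * Complex.I) := by
    rw [zeta]; congr 1; push_cast; ring
  rw [this, Complex.norm_exp_ofReal_mul_I]

theorem secondModulus_nonneg (M : Matrix m m ℝ) : 0 ≤ secondModulus M :=
  Real.sSup_nonneg (by rintro _ ⟨z, -, rfl⟩; exact norm_nonneg z)

theorem finite_nondominant (M : Matrix m m ℝ) :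
    ((fun μ : ℂ => ‖μ‖) '' {μ ∈ eigenvalues M | ‖μ‖ < pfEigenvalue M}).Finite :=
  ((finite_eigenvalues M).subset fun _ hz => hz.1).image _

theorem norm_le_secondModulus {M : Matrix m m ℝ} {z : ℂ}
    (hz : (M.map Complex.ofReal).charpoly.IsRoot z) (hlt : ‖z‖ < pfEigenvalue M) :
    ‖z‖ ≤ secondModulus M :=
  le_csSup (finite_nondominant M).bddAbove ⟨z, ⟨(mem_eigenvalues_iff _ _).2 hz, hlt⟩, rfl⟩

/-- The supremum runs over a finite set and is attained. When the set is empty it is `0`, which is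
where positivity of `λ` enters. -/
theorem secondModulus_lt {M : Matrix m m ℝ} (hpos : 0 < pfEigenvalue M) :
    secondModulus M < pfEigenvalue M := by
  rcases Set.eq_empty_or_nonempty
    ((fun μ : ℂ => ‖μ‖) '' {μ ∈ eigenvalues M | ‖μ‖ < pfEigenvalue M}) with he | hne
  · rwa [secondModulus, he, Real.sSup_empty]
  · obtain ⟨z, hz, hzs⟩ := hne.csSup_mem (finite_nondominant M)
    rw [secondModulus, ← hzs]
    exact hz.2

theorem IsNormalizedEigensystem.exists_norm_sub_asymptoticFormula_le {M : Matrix m m ℝ}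
    (hM : ∀ i j, 0 ≤ M i j) (hPF : HasPerronFrobeniusProperty M) {h : ℕ} (hh : IsPeriod M h)
    {v w : Fin h → m → ℂ} (hvw : IsNormalizedEigensystem M v w) (j : m) {ρ : ℝ}
    (hρ : secondModulus M < ρ) :
    ∃ B, ∀ n : ℕ, ‖((∑ i, (M ^ n) i j : ℝ) : ℂ) - asymptoticFormula M j v w n‖ ≤ B * ρ ^ n := by
  obtain ⟨B, hB⟩ := exists_norm_pow_sub_sum_le (M.map Complex.ofReal)
    (μ := fun k : Fin h => zeta h ^ (k : ℕ) * (pfEigenvalue M : ℂ))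
    (fun a b hab => Fin.ext (hh.2.injOn a.2 b.2 hab)) (hh.rootMultiplicity_eq_one hM hPF)
    (fun k => (hvw k).1) (fun k => (hvw k).2.1) (fun k => (hvw k).2.2)
    (secondModulus_nonneg M) hρ (fun z hz hzr => by
      refine norm_le_secondModulus hz (lt_of_le_of_ne (norm_le_pfEigenvalue M hz) fun heq => hzr ?_)
      obtain ⟨k, hk, hkz⟩ := hh.2.surjOn ⟨(mem_eigenvalues_iff _ _).2 hz, heq⟩
      exact ⟨⟨k, hk⟩, hkz⟩)
  refine ⟨Fintype.card m * B, fun n => ?_⟩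
  have hpow : (M.map Complex.ofReal) ^ n = (M ^ n).map Complex.ofReal :=
    (Matrix.map_pow (f := Complex.ofRealHom) M n).symm
  have heq : ((∑ i, (M ^ n) i j : ℝ) : ℂ) - asymptoticFormula M j v w n
      = ∑ i, (((M.map Complex.ofReal) ^ n) i j - ∑ k : Fin h,
        (zeta h ^ (k : ℕ) * (pfEigenvalue M : ℂ)) ^ n * (v k i * w k j)) := by
    rw [Finset.sum_sub_distrib, hpow, Complex.ofReal_sum, Finset.sum_comm, asymptoticFormula,
      Finset.sum_mul]
    congr 1
    refine Finset.sum_congr rfl fun k _ => ?_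
    rw [← Finset.mul_sum, columnSum, mul_pow]
    simp only [vecMulVec_apply]
    ring
  rw [heq]
  refine (norm_sum_le _ _).trans ((Finset.sum_le_sum fun i _ => hB n i j).trans (le_of_eq ?_))
  rw [Finset.sum_const, Finset.card_univ, nsmul_eq_mul, mul_assoc]

theorem exists_norm_asymptoticFormula_le (M : Matrix m m ℝ) (j : m) {h : ℕ}
    (v w : Fin h → m → ℂ) :
    ∃ B, ∀ n : ℕ, ‖asymptoticFormula M j v w n‖ ≤ B * pfEigenvalue M ^ n := by
  refine ⟨∑ k, ‖columnSum (vecMulVec (v k) (w k)) j‖, fun n => ?_⟩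
  rw [asymptoticFormula, norm_mul, norm_pow, norm_pfEigenvalue]
  refine mul_le_mul_of_nonneg_right ((norm_sum_le _ _).trans (le_of_eq ?_))
    (pow_nonneg (pfEigenvalue_nonneg M) n)
  simp [norm_zeta]

end Period

/-! ### From error bounds to quotients and `n`-th roots. -/

section Limits

variable {b : ℕ → ℝ} {a : ℕ → ℂ} {r β c : ℝ}

theorem convergesGeometrically_sub_div (hr : 0 < r) (hβ0 : 0 ≤ β) (hβ1 : β < 1)
    (hba : ∀ γ, β < γ → γ < 1 → ∃ B, ∀ n : ℕ, ‖(b n : ℂ) - a n‖ ≤ B * (r * γ) ^ n) :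
    ConvergesGeometrically (fun n => ((b n : ℂ) - a n) / (r : ℂ) ^ n) 0 β := by
  refine ⟨hβ0, hβ1, fun γ hγ hγ1 => ?_⟩
  obtain ⟨B, hB⟩ := hba γ hγ hγ1
  have hγ0 : 0 < γ := hβ0.trans_lt hγ
  refine ⟨B, fun n => ?_⟩
  rw [sub_zero, div_div, ← mul_pow, norm_div, norm_pow, norm_mul, Complex.norm_real,
    Complex.norm_real, Real.norm_of_nonneg hr.le, Real.norm_of_nonneg hγ0.le,
    div_le_iff₀ (pow_pos (mul_pos hr hγ0) n)]
  exact hB n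

theorem eventually_le_norm (hr : 0 < r) (hβ0 : 0 ≤ β) (hβ1 : β < 1) (hc : 0 < c)
    (hb : ∀ n, c * r ^ n ≤ b n)
    (hba : ∀ γ, β < γ → γ < 1 → ∃ B, ∀ n : ℕ, ‖(b n : ℂ) - a n‖ ≤ B * (r * γ) ^ n) :
    ∀ᶠ n in atTop, c / 2 * r ^ n ≤ ‖a n‖ := by
  obtain ⟨γ, hγ, hγ1⟩ := exists_between hβ1
  obtain ⟨B, hB⟩ := hba γ hγ hγ1
  have hlim : Tendsto (fun n : ℕ => B * γ ^ n) atTop (𝓝 0) := by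
    simpa using (tendsto_pow_atTop_nhds_zero_of_lt_one (hβ0.trans hγ.le) hγ1).const_mul B
  filter_upwards [hlim.eventually (gt_mem_nhds (half_pos hc))] with n hn
  have h1 : ‖(b n : ℂ)‖ ≤ ‖(b n : ℂ) - a n‖ + ‖a n‖ := by
    simpa using norm_add_le ((b n : ℂ) - a n) (a n)
  rw [Complex.norm_real] at h1
  have h2 := (hb n).trans ((le_abs_self _).trans h1)
  have h3 := hB n
  rw [mul_pow, mul_left_comm] at h3
  have h4 : r ^ n * (B * γ ^ n) ≤ r ^ n * (c / 2) :=
    mul_le_mul_of_nonneg_left hn.le (pow_pos hr n).le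
  linarith

theorem convergesGeometrically_div (hr : 0 < r) (hβ0 : 0 ≤ β) (hβ1 : β < 1) (hc : 0 < c)
    (hb : ∀ n, c * r ^ n ≤ b n)
    (hba : ∀ γ, β < γ → γ < 1 → ∃ B, ∀ n : ℕ, ‖(b n : ℂ) - a n‖ ≤ B * (r * γ) ^ n) :
    ConvergesGeometrically (fun n => (b n : ℂ) / a n) 1 β := by
  refine ⟨hβ0, hβ1, fun γ hγ hγ1 => ?_⟩
  obtain ⟨B, hB⟩ := hba γ hγ hγ1
  have hγ0 : 0 < γ := hβ0.trans_lt hγ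
  -- `a n` is only known to be nonzero for large `n`; the finitely many other terms, including any
  -- divisions by zero, are absorbed into the bound.
  refine exists_forall_le_of_eventually_le (B := B * (2 / c)) ?_
  filter_upwards [eventually_le_norm hr hβ0 hβ1 hc hb hba] with n hn
  have hrn : 0 < r ^ n := pow_pos hr n
  have hcn : 0 < c / 2 * r ^ n := mul_pos (half_pos hc) hrn
  have ha0 : a n ≠ 0 := norm_ne_zero_iff.1 (hcn.trans_le hn).ne'
  rw [div_sub_one ha0, div_div, norm_div, norm_mul, norm_pow, Complex.norm_real,
    Real.norm_of_nonneg hγ0.le]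
  have hγn : 0 < γ ^ n := pow_pos hγ0 n
  calc ‖(b n : ℂ) - a n‖ / (‖a n‖ * γ ^ n) ≤ B * (r * γ) ^ n / (c / 2 * r ^ n * γ ^ n) :=
        div_le_div₀ ((norm_nonneg _).trans (hB n)) (hB n) (mul_pos hcn hγn)
          (mul_le_mul_of_nonneg_right hn hγn.le)
    _ = B * (2 / c) := by rw [mul_pow]; field_simp

theorem ConvergesGeometrically.tendsto {f : ℕ → ℂ} {l : ℂ} (h : ConvergesGeometrically f l β) :
    Tendsto f atTop (𝓝 l) := by
  obtain ⟨hβ0, hβ1, h⟩ := h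
  obtain ⟨γ, hγ, hγ1⟩ := exists_between hβ1
  obtain ⟨B, hB⟩ := h γ hγ hγ1
  have hγ0 : 0 < γ := hβ0.trans_lt hγ
  rw [tendsto_iff_norm_sub_tendsto_zero]
  refine squeeze_zero (fun _ => norm_nonneg _) (g := fun n => B * γ ^ n) (fun n => ?_) ?_
  · have h1 := hB n
    rwa [norm_div, norm_pow, Complex.norm_real, Real.norm_of_nonneg hγ0.le,
      div_le_iff₀ (pow_pos hγ0 n)] at h1
  · simpa using (tendsto_pow_atTop_nhds_zero_of_lt_one hγ0.le hγ1).const_mul B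

theorem tendsto_const_mul_pow_rpow {c r : ℝ} (hc : 0 < c) (hr : 0 ≤ r) :
    Tendsto (fun n : ℕ => (c * r ^ n) ^ (1 / (n : ℝ))) atTop (𝓝 r) := by
  have h1 : Tendsto (fun n : ℕ => c ^ (1 / (n : ℝ)) * r) atTop (𝓝 (c ^ (0 : ℝ) * r)) :=
    ((Real.continuousAt_const_rpow hc.ne').tendsto.comp
      tendsto_one_div_atTop_nhds_zero_nat).mul_const r
  rw [Real.rpow_zero, one_mul] at h1
  refine h1.congr' ?_
  filter_upwards [eventually_gt_atTop 0] with n hn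
  rw [Real.mul_rpow hc.le (pow_nonneg hr n), one_div, Real.pow_rpow_inv_natCast hr hn.ne']

theorem tendsto_rpow_of_le_of_le {C : ℝ} (hr : 0 < r) (hc : 0 < c) (hb : ∀ n, c * r ^ n ≤ b n)
    (hb' : ∀ n, b n ≤ C * r ^ n) : Tendsto (fun n : ℕ => b n ^ (1 / (n : ℝ))) atTop (𝓝 r) := by
  have hC : 0 < C := by
    have := (hb 0).trans (hb' 0)
    simp only [pow_zero, mul_one] at this
    exact hc.trans_le this
  refine tendsto_of_tendsto_of_tendsto_of_le_of_le (tendsto_const_mul_pow_rpow hc hr.le)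
    (tendsto_const_mul_pow_rpow hC hr.le) (fun n => ?_) (fun n => ?_)
  · exact Real.rpow_le_rpow (by positivity) (hb n) (by positivity)
  · exact Real.rpow_le_rpow (le_trans (by positivity) (hb n)) (hb' n) (by positivity)

end Limits

/-! ### Multiplication by `c` in the based algebra. -/

namespace FiniteBasedAlgebra

variable {K : Subring ℂ} {R : Type*} [Ring R] [Algebra K R] {ι : Type*} [Fintype ι]
  (C : FiniteBasedAlgebra K R ι)

theorem structureConst_nonneg (i j k : ι) : 0 ≤ C.structureConst i j k :=
  (Complex.le_def.1 (C.structure_nonneg i j k)).1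

theorem ofReal_structureConst (i j k : ι) :
    (C.structureConst i j k : ℂ) = ((C.basis.repr (C.basis i * C.basis j) k : K) : ℂ) :=
  Complex.ext rfl (by simpa using (Complex.le_def.1 (C.structure_nonneg i j k)).2)

theorem preActionMatrix_nonneg {x : ι → ℝ} (hx : ∀ i, 0 ≤ x i) (k j : ι) :
    0 ≤ C.preActionMatrix x k j :=
  Finset.sum_nonneg fun i _ => mul_nonneg (hx i) (C.structureConst_nonneg i j k)

theorem repr_basis_mul_basis (i j k : ι) :
    (C.basis.baseChange ℂ).repr (C.basis.baseChange ℂ i * C.basis.baseChange ℂ j) k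
      = C.structureConst i j k := by
  rw [Module.Basis.baseChange_apply, Module.Basis.baseChange_apply,
    Algebra.TensorProduct.tmul_mul_tmul, one_mul, Module.Basis.baseChange_repr_tmul,
    ofReal_structureConst, Subring.smul_def, smul_eq_mul, mul_one]

theorem repr_mul_basis (y : ℂ ⊗[K] R) (j k : ι) :
    (C.basis.baseChange ℂ).repr (y * C.basis.baseChange ℂ j) k
      = ∑ i, (C.basis.baseChange ℂ).repr y i * C.structureConst i j k := by
  conv_lhs => rw [← (C.basis.baseChange ℂ).sum_repr y]
  simp only [Finset.sum_mul, smul_mul_assoc, map_sum, map_smul, Finsupp.finsetSum_apply,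
    Finsupp.smul_apply, repr_basis_mul_basis, smul_eq_mul]

theorem element_eq_sum_smul (x : ι → ℝ) :
    C.element x = ∑ i, (x i : ℂ) • C.basis.baseChange ℂ i := by
  simp [element, Module.Basis.baseChange_apply, TensorProduct.smul_tmul']

theorem repr_element_mul (x : ι → ℝ) (y : ℂ ⊗[K] R) (k : ι) :
    (C.basis.baseChange ℂ).repr (C.element x * y) k
      = ∑ j, (C.preActionMatrix x k j : ℂ) * (C.basis.baseChange ℂ).repr y j := by
  conv_lhs => rw [← (C.basis.baseChange ℂ).sum_repr y, element_eq_sum_smul]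
  simp only [Finset.mul_sum, Finset.sum_mul, smul_mul_assoc, mul_smul_comm, map_sum, map_smul,
    Finsupp.finsetSum_apply, Finsupp.smul_apply, repr_basis_mul_basis, smul_eq_mul,
    preActionMatrix, Matrix.of_apply, Complex.ofReal_sum, Complex.ofReal_mul]
  exact Finset.sum_congr rfl fun j _ => Finset.sum_congr rfl fun i _ => by ring

theorem baseChange_one : C.basis.baseChange ℂ C.one = 1 := by
  rw [Module.Basis.baseChange_apply, C.basis_one, Algebra.TensorProduct.one_def]

theorem mem_component_of_ne_zero {x : ι → ℝ} {k j : ι} (hj : j ∈ C.component x)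
    (h : C.preActionMatrix x k j ≠ 0) : k ∈ C.component x := by
  simp only [component, Finset.mem_filter_univ] at hj ⊢
  exact hj.trans _ _ _ ((Relation.EqvGen.rel k j h).symm _ _)

theorem actionMatrix_nonneg {x : ι → ℝ} (hx : ∀ i, 0 ≤ x i) (k j : C.component x) :
    0 ≤ C.actionMatrix x k j := C.preActionMatrix_nonneg hx k j

variable [DecidableEq ι]

theorem repr_pow_mul_basis (x : ι → ℝ) (n : ℕ) (j k : ι) :
    (C.basis.baseChange ℂ).repr (C.element x ^ n * C.basis.baseChange ℂ j) k
      = ((C.preActionMatrix x ^ n) k j : ℝ) := by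
  induction n generalizing k with
  | zero =>
    rw [pow_zero, one_mul, Module.Basis.repr_self, pow_zero, Finsupp.single_apply, Matrix.one_apply]
    simp only [eq_comm (a := k)]
    split_ifs <;> simp
  | succ n ih =>
    rw [pow_succ', mul_assoc, repr_element_mul, pow_succ', Matrix.mul_apply]
    simp only [ih, Complex.ofReal_sum, Complex.ofReal_mul]

theorem repr_pow (x : ι → ℝ) (n : ℕ) (k : ι) :
    (C.basis.baseChange ℂ).repr (C.element x ^ n) k
      = ((C.preActionMatrix x ^ n) k C.one : ℝ) := by
  rw [← repr_pow_mul_basis, baseChange_one, mul_one]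

theorem growth_eq_sum (x : ι → ℝ) (n : ℕ) :
    C.growth x n = ∑ k, (C.preActionMatrix x ^ n) k C.one := by
  simp [growth, repr_pow]

theorem preActionMatrix_apply_one (x : ι → ℝ) (k : ι) : C.preActionMatrix x k C.one = x k := by
  have h1 := C.repr_pow x 1 k
  rw [pow_one, pow_one, element_eq_sum_smul] at h1
  have h2 : (x k : ℂ) = C.preActionMatrix x k C.one := by
    simpa only [map_sum, map_smul, Module.Basis.repr_self, Finsupp.finsetSum_apply,
      Finsupp.smul_apply, Finsupp.single_apply, smul_eq_mul, mul_ite, mul_one, mul_zero,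
      Finset.sum_ite_eq', Finset.mem_univ, if_true] using h1
  exact_mod_cast h2.symm

/-- Left multiplication by `c ^ n` is determined by the coefficients of `c ^ n`. -/
theorem preActionMatrix_pow_apply (x : ι → ℝ) (n : ℕ) (k j : ι) :
    (C.preActionMatrix x ^ n) k j
      = ∑ i, (C.preActionMatrix x ^ n) i C.one * C.structureConst i j k := by
  have h := C.repr_mul_basis (C.element x ^ n) j k
  rw [repr_pow_mul_basis] at h
  simp only [repr_pow] at h
  exact_mod_cast h

theorem preActionMatrix_pow_nonneg {x : ι → ℝ} (hx : ∀ i, 0 ≤ x i) (n : ℕ) (k j : ι) :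
    0 ≤ (C.preActionMatrix x ^ n) k j := by
  induction n generalizing k with
  | zero => rw [pow_zero, Matrix.one_apply]; split_ifs <;> norm_num
  | succ n ih =>
    rw [pow_succ', Matrix.mul_apply]
    exact Finset.sum_nonneg fun l _ => mul_nonneg (C.preActionMatrix_nonneg hx k l) (ih l)

theorem growth_nonneg {x : ι → ℝ} (hx : ∀ i, 0 ≤ x i) (n : ℕ) : 0 ≤ C.growth x n := by
  rw [growth_eq_sum]
  exact Finset.sum_nonneg fun k _ => C.preActionMatrix_pow_nonneg hx n k C.one

/-- The column at `1` controls every column, because `c ^ n * c_j` is computed from the coefficients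
of `c ^ n`. The sum of all structure constants is a crude bound for each of them. -/
theorem preActionMatrix_pow_le {x : ι → ℝ} (hx : ∀ i, 0 ≤ x i) (n : ℕ) (k j : ι) :
    (C.preActionMatrix x ^ n) k j ≤ (∑ i, ∑ j, ∑ k, C.structureConst i j k) * C.growth x n := by
  rw [preActionMatrix_pow_apply, growth_eq_sum, Finset.mul_sum]
  refine Finset.sum_le_sum fun i _ => ?_
  rw [mul_comm]
  refine mul_le_mul_of_nonneg_right ?_ (C.preActionMatrix_pow_nonneg hx n i C.one)
  have h0 := C.structureConst_nonneg
  calc C.structureConst i j k ≤ ∑ k, C.structureConst i j k :=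
        Finset.single_le_sum (fun k _ => h0 i j k) (Finset.mem_univ k)
    _ ≤ ∑ j, ∑ k, C.structureConst i j k :=
        Finset.single_le_sum (f := fun j => ∑ k, C.structureConst i j k)
          (fun j _ => Finset.sum_nonneg fun k _ => h0 i j k) (Finset.mem_univ j)
    _ ≤ ∑ i, ∑ j, ∑ k, C.structureConst i j k :=
        Finset.single_le_sum (f := fun i => ∑ j, ∑ k, C.structureConst i j k)
          (fun i _ => Finset.sum_nonneg fun j _ => Finset.sum_nonneg fun k _ => h0 i j k)
          (Finset.mem_univ i)

/-- No nonzero entry joins the component to its complement, so powers of `M'` restrict to powers of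
`M`. -/
theorem preActionMatrix_pow_component (x : ι → ℝ) (n : ℕ) (j : C.component x) :
    (∀ k : C.component x, (C.preActionMatrix x ^ n) k j = (C.actionMatrix x ^ n) k j) ∧
      ∀ k ∉ C.component x, (C.preActionMatrix x ^ n) k j = 0 := by
  induction n with
  | zero =>
    refine ⟨fun k => by
      simp only [pow_zero, Matrix.one_apply, Subtype.ext_iff], fun k hk => ?_⟩
    rw [pow_zero, Matrix.one_apply_ne]
    rintro rfl
    exact hk j.2
  | succ n ih =>
    have hsum : ∀ k, (C.preActionMatrix x ^ (n + 1)) k j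
        = ∑ l : C.component x, C.preActionMatrix x k l * (C.actionMatrix x ^ n) l j := by
      intro k
      rw [pow_succ', Matrix.mul_apply, ← Finset.sum_subset (Finset.subset_univ (C.component x))
        (fun l _ hl => by rw [ih.2 l hl, mul_zero]), ← Finset.sum_coe_sort]
      exact Finset.sum_congr rfl fun l _ => by rw [ih.1 l]
    refine ⟨fun k => ?_, fun k hk => ?_⟩
    · rw [hsum, pow_succ', Matrix.mul_apply]; rfl
    · rw [hsum]
      refine Finset.sum_eq_zero fun l _ => ?_
      rw [not_imp_comm.1 (C.mem_component_of_ne_zero l.2) hk, zero_mul]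

theorem growth_eq_sum_actionMatrix (x : ι → ℝ) (n : ℕ) :
    C.growth x n = ∑ k, (C.actionMatrix x ^ n) k (C.oneVertex x) := by
  have h : (∀ k : C.component x, (C.preActionMatrix x ^ n) k C.one
      = (C.actionMatrix x ^ n) k (C.oneVertex x)) ∧
      ∀ k ∉ C.component x, (C.preActionMatrix x ^ n) k C.one = 0 :=
    C.preActionMatrix_pow_component x n (C.oneVertex x)
  rw [growth_eq_sum, ← Finset.sum_subset (Finset.subset_univ (C.component x))
    (fun l _ hl => h.2 l hl), ← Finset.sum_coe_sort]
  exact Finset.sum_congr rfl fun l _ => h.1 l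

/-- The growth sequence is bounded below by a multiple of the powers of the Perron--Frobenius
eigenvalue: the coefficients of `c ^ n` bound the entries of the `n`-th power of the action
matrix. -/
theorem exists_mul_pow_le_growth {x : ι → ℝ} (hx : ∀ i, 0 ≤ x i)
    (hPF : HasPerronFrobeniusProperty (C.actionMatrix x)) :
    ∃ c, 0 < c ∧ ∀ n, c * pfEigenvalue (C.actionMatrix x) ^ n ≤ C.growth x n := by
  set M := C.actionMatrix x
  obtain ⟨v, hv0, hvne, hMv⟩ := exists_nonneg_eigenvector (C.actionMatrix_nonneg hx)
    (fun z hz => norm_le_pfEigenvalue M hz) hPF.isRoot (norm_pfEigenvalue M)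
  obtain ⟨i, hi⟩ := Function.ne_iff.1 hvne
  have hvi : 0 < v i := lt_of_le_of_ne (hv0 i) (Ne.symm hi)
  have hpow : ∀ n : ℕ, (M ^ n) *ᵥ v = pfEigenvalue M ^ n • v := by
    intro n
    induction n with
    | zero => simp
    | succ n ih => rw [pow_succ', ← Matrix.mulVec_mulVec, ih, Matrix.mulVec_smul, hMv, smul_smul,
        pow_succ]
  set D := ∑ i, ∑ j, ∑ k, C.structureConst i j k
  have hle : ∀ n : ℕ, v i * pfEigenvalue M ^ n ≤ (D * ∑ j, v j) * C.growth x n := by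
    intro n
    have h1 := congrFun (hpow n) i
    rw [Pi.smul_apply, smul_eq_mul, mul_comm] at h1
    rw [← h1, mul_right_comm, Finset.mul_sum]
    refine Finset.sum_le_sum fun j _ => mul_le_mul_of_nonneg_right ?_ (hv0 j)
    exact ((C.preActionMatrix_pow_component x n j).1 i).symm.trans_le
      (C.preActionMatrix_pow_le hx n i j)
  -- Read off from the bound at `n = 0`, whose left side is `v i > 0`.
  have hE : 0 < D * ∑ j, v j := by
    have h1 := hle 0
    rw [pow_zero, mul_one] at h1
    exact pos_of_mul_pos_left (hvi.trans_le h1) (C.growth_nonneg hx 0)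
  refine ⟨v i / (D * ∑ j, v j), div_pos hvi hE, fun n => ?_⟩
  rw [div_mul_eq_mul_div, div_le_iff₀ hE, mul_comm (C.growth x n)]
  exact hle n

/-- If `λ = 0` then every eigenvalue is `0`, and simplicity forces `M` to be `1 × 1`; its single
entry is the trace, hence `0`. Any `k` with `x k ≠ 0` is adjacent to `1`, because the column of `M'`
at `1` is `x`, so the component would be larger unless `x = 0`. -/
theorem eq_zero_of_pfEigenvalue_eq_zero {x : ι → ℝ}
    (hPF : HasPerronFrobeniusProperty (C.actionMatrix x))
    (h0 : pfEigenvalue (C.actionMatrix x) = 0) : x = 0 := by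
  set M := C.actionMatrix x
  set p := (M.map Complex.ofReal).charpoly with hp
  have hroots : ∀ z ∈ p.roots, z = 0 := fun z hz => by
    have := norm_le_pfEigenvalue M (Polynomial.isRoot_of_mem_roots hz)
    rw [h0] at this
    exact norm_le_zero_iff.1 this
  have hrep := Multiset.eq_replicate_card.2 hroots
  have hcard : Fintype.card (C.component x) = 1 := by
    have h1 := hPF.rootMultiplicity_map
    rw [h0, Complex.ofReal_zero, ← Polynomial.count_roots, ← hp, hrep, Multiset.count_replicate_self,
      IsAlgClosed.card_roots_eq_natDegree, hp, Matrix.charpoly_natDegree_eq_dim] at h1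
    exact h1
  have htrace : M.trace = 0 := by
    have h1 := Matrix.trace_eq_sum_roots_charpoly (M.map Complex.ofReal)
    rw [← hp, hrep, Multiset.sum_replicate, smul_zero] at h1
    have h2 : ((M.trace : ℝ) : ℂ) = 0 := by
      rw [← h1]; simp [Matrix.trace]
    exact_mod_cast h2
  have hsub : Subsingleton (C.component x) := Fintype.card_le_one_iff_subsingleton.1 hcard.le
  have hone : x C.one = 0 := by
    rw [Matrix.trace, Fintype.sum_subsingleton _ (C.oneVertex x)] at htrace
    rw [← C.preActionMatrix_apply_one x]
    exact htrace
  ext k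
  by_contra hk
  have hmem : k ∈ C.component x := C.mem_component_of_ne_zero (C.oneVertex x).2
    (by rw [oneVertex, C.preActionMatrix_apply_one]; exact hk)
  have : k = C.one := congrArg Subtype.val (Subsingleton.elim (⟨k, hmem⟩ : C.component x)
    (C.oneVertex x))
  exact hk (this ▸ hone)

end FiniteBasedAlgebra

end BasedAlgebra

/-! ### Assembly of the main theorem. -/

open BasedAlgebra in
theorem mainTheorem5 {K : Subring ℂ} {R : Type*} [Ring R] [Algebra K R]
    {ι : Type*} [Fintype ι] [DecidableEq ι] (C : FiniteBasedAlgebra K R ι)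
    (x : ι → ℝ) (hx : ∀ i, 0 ≤ x i)
    (hPF : HasPerronFrobeniusProperty (C.actionMatrix x)) :
    (∃ h : ℕ, IsPeriod (C.actionMatrix x) h ∧
      (∃ v w : Fin h → C.component x → ℂ, IsNormalizedEigensystem (C.actionMatrix x) v w) ∧
      ∀ v w : Fin h → C.component x → ℂ, IsNormalizedEigensystem (C.actionMatrix x) v w →
        Asymptotics.IsEquivalent Filter.atTop (fun n : ℕ => (C.growth x n : ℂ))
          (asymptoticFormula (C.actionMatrix x) (C.oneVertex x) v w) ∧
        (x ≠ 0 → ConvergesGeometrically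
          (fun n : ℕ => (C.growth x n : ℂ) /
            asymptoticFormula (C.actionMatrix x) (C.oneVertex x) v w n) 1
          (secondModulus (C.actionMatrix x) / pfEigenvalue (C.actionMatrix x))) ∧
        ConvergesGeometrically
          (fun n : ℕ => ((C.growth x n : ℂ) -
            asymptoticFormula (C.actionMatrix x) (C.oneVertex x) v w n) /
              (pfEigenvalue (C.actionMatrix x) : ℂ) ^ n) 0
          (secondModulus (C.actionMatrix x) / pfEigenvalue (C.actionMatrix x))) ∧
    Filter.Tendsto (fun n : ℕ => C.growth x n ^ (1 / (n : ℝ))) Filter.atTop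
      (nhds (pfEigenvalue (C.actionMatrix x))) := by
  have hM := C.actionMatrix_nonneg hx
  obtain ⟨h, hh⟩ := exists_isPeriod hM hPF
  have hsys := hh.exists_isNormalizedEigensystem hM hPF
  rcases (pfEigenvalue_nonneg (C.actionMatrix x)).eq_or_lt with h0 | hpos
  · have hx0 : x = 0 := C.eq_zero_of_pfEigenvalue_eq_zero hPF h0.symm
    have hgrowth : ∀ n : ℕ, n ≠ 0 → C.growth x n = 0 := fun n hn => by
      simp [FiniteBasedAlgebra.growth, C.element_eq_sum_smul, hx0, hn]
    refine ⟨⟨h, hh, hsys, fun v w _ => ⟨?_, fun hne => absurd hx0 hne, ?_⟩⟩, ?_⟩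
    · refine Filter.EventuallyEq.isEquivalent ?_
      filter_upwards [Filter.eventually_ne_atTop 0] with n hn
      simp [hgrowth n hn, asymptoticFormula, ← h0, hn]
    -- With `λ = 0` the ratio `β` is `0` by the convention for division by zero, and every term with
    -- `n ≠ 0` vanishes because it is divided by `0 ^ n = 0`.
    · rw [← h0, div_zero]
      refine ⟨le_rfl, one_pos, fun γ _ _ => exists_forall_le_of_eventually_le (B := 0) ?_⟩
      filter_upwards [Filter.eventually_ne_atTop 0] with n hn
      simp [hn]
    · rw [← h0]
      refine tendsto_const_nhds.congr' ?_
      filter_upwards [Filter.eventually_ne_atTop 0] with n hn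
      rw [hgrowth n hn, Real.zero_rpow (by positivity)]
  · obtain ⟨c, hc, hlow⟩ := C.exists_mul_pow_le_growth hx hPF
    have hβ0 : 0 ≤ secondModulus (C.actionMatrix x) / pfEigenvalue (C.actionMatrix x) :=
      div_nonneg (secondModulus_nonneg _) hpos.le
    have hβ1 : secondModulus (C.actionMatrix x) / pfEigenvalue (C.actionMatrix x) < 1 :=
      (div_lt_one hpos).2 (secondModulus_lt hpos)
    have hba : ∀ v w : Fin h → C.component x → ℂ,
        IsNormalizedEigensystem (C.actionMatrix x) v w →
        ∀ γ, secondModulus (C.actionMatrix x) / pfEigenvalue (C.actionMatrix x) < γ → γ < 1 →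
        ∃ B, ∀ n : ℕ, ‖(C.growth x n : ℂ) -
          asymptoticFormula (C.actionMatrix x) (C.oneVertex x) v w n‖ ≤
            B * (pfEigenvalue (C.actionMatrix x) * γ) ^ n := by
      intro v w hvw γ hγ _
      have hρ : secondModulus (C.actionMatrix x) < pfEigenvalue (C.actionMatrix x) * γ := by
        rwa [div_lt_iff₀' hpos] at hγ
      simp only [C.growth_eq_sum_actionMatrix]
      exact hvw.exists_norm_sub_asymptoticFormula_le hM hPF hh (C.oneVertex x) hρ
    refine ⟨⟨h, hh, hsys, fun v w hvw => ?_⟩, ?_⟩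
    · have hdiv := convergesGeometrically_div hpos hβ0 hβ1 hc hlow (hba v w hvw)
      exact ⟨Asymptotics.isEquivalent_of_tendsto_one hdiv.tendsto, fun _ => hdiv,
        convergesGeometrically_sub_div hpos hβ0 hβ1 (hba v w hvw)⟩
    · obtain ⟨v, w, hvw⟩ := hsys
      obtain ⟨γ, hγ, hγ1⟩ := exists_between hβ1
      obtain ⟨B, hB⟩ := hba v w hvw γ hγ hγ1
      obtain ⟨B', hB'⟩ := exists_norm_asymptoticFormula_le (C.actionMatrix x) (C.oneVertex x) v w
      -- Upper bound: the error is at most `B λ ^ n` since `γ < 1`, and `a(n)` is at most `B' λ ^ n`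
      -- since `ζ` has modulus one.
      refine tendsto_rpow_of_le_of_le (C := B + B') hpos hc hlow fun n => ?_
      have hγ0 : 0 ≤ γ := hβ0.trans hγ.le
      have hB0 : 0 ≤ B := by simpa using (norm_nonneg _).trans (hB 0)
      have h1 : C.growth x n ≤ ‖(C.growth x n : ℂ)‖ := by
        rw [Complex.norm_real]; exact le_abs_self _
      have h2 : ‖(C.growth x n : ℂ)‖ ≤ ‖(C.growth x n : ℂ) -
          asymptoticFormula (C.actionMatrix x) (C.oneVertex x) v w n‖ +
          ‖asymptoticFormula (C.actionMatrix x) (C.oneVertex x) v w n‖ := by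
        simpa using norm_add_le ((C.growth x n : ℂ) -
          asymptoticFormula (C.actionMatrix x) (C.oneVertex x) v w n)
          (asymptoticFormula (C.actionMatrix x) (C.oneVertex x) v w n)
      have h3 : B * (pfEigenvalue (C.actionMatrix x) * γ) ^ n
          ≤ B * pfEigenvalue (C.actionMatrix x) ^ n :=
        mul_le_mul_of_nonneg_left (pow_le_pow_left₀ (mul_nonneg hpos.le hγ0)
          (mul_le_of_le_one_right hpos.le hγ1.le) n) hB0
      rw [add_mul]
      exact h1.trans (h2.trans (add_le_add ((hB n).trans h3) (hB' n)))
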